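/- **Colored framed graph diagrams.** Let $G\subset S^3$ be an oriented framed trivalent graph without source or sink (circle components allowed). A coloring assigns to each edge a pair $(j,J)\in(\mathbb Z\setminus\{0\})\times\mathbb Z$ (multiplicity, weight) such that at each vertex, with $\epsilon=-1$ for an edge pointing toward the vertex and $\epsilon=1$ otherwise, $\sum\epsilon_rj_r=0$ and $\sum\epsilon_rJ_r=-\prod\epsilon_r$. $G$ is given by a plane diagram with the blackboard framing and half-twist symbols. Put $\{k\}_q=q^k-q^{-k}$. **Viro's polynomial.** Cut the diagram $D$ at a point of an edge, of color $(j,J)$, on the boundary of the unbounded region, and put it in Morse position with the two new endpoints at the bottom and at the top. A state assigns $e_0$ or $e_1$ to the pieces of edge between the minima, maxima, crossings, half twists and vertices; composing (bottom to top) the matrices of the Boltzmann weights below gives a $2\times2$ matrix, in the basis $e_0,e_1$, which is a scalar matrix $\lambda\cdot\mathrm{id}$ with $\lambda\in\mathbb Q(q)$, and $(D)=\underline\Delta(D,c)=\lambda/\{2j\}_q$. The weights not listed are $0$. * Strand of color $(j,J)$ in state $(e_0;e_1)$. Minimum: $(1;-q^{2j})$ if directed from right to left, $(q^{-2j};1)$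 if from left to right. Maximum: $(1;-q^{-2j})$ from right to left, $(q^{2j};1)$ from left to right. Positive half twist $q^{-jJ}$, negative half twist $q^{jJ}$, in both states. * Crossing of two upward strands, $(i,I)$ from bottom left to top right and $(j,J)$ from bottom right to top left; an entry $ab\to cd$ is for $e_a\otimes e_b\mapsto e_c\otimes e_d$. With $m=iJ+jI$, if the strand $(i,I)$ is over: $00\to00$: $q^{-m+i+j}$; $01\to10$: $q^{-m+j-i}$; $10\to01$: $q^{-m+i-j}$; $11\to11$: $-q^{-m-i-j}$; $01\to01$: $(q^{4i}-1)q^{-m-i-j}$. If it is under: $q^{m-i-j}$, $q^{m+i-j}$, $q^{m+j-i}$, $-q^{m+i+j}$ for the first four, and $10\to10$: $(1-q^{4j})q^{m-i-j}$. Crossings with other directions are obtained by rotating these with a minimum and a maximum. * Vertex with one edge (multiplicity $k$) below and two above ($i$ left, $j$ right); the four numbers are for the states (lower; upper left, upper right) $=(0;00),(0;11),(1;10),(1;01)$, and the arrows give the directions (lower; left, right): $(\uparrow;\uparrow\uparrow)$: $\{2k\}_q,0,\{2i\}_qq^{-2j},\{2j\}_q$; $(\uparrow;\uparrow\downarrow)$: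 $1,-q^{2i},1,0$; $(\downarrow;\uparrow\downarrow)$: $\{2j\}_q,-\{2i\}_qq^{2j},0,\{2k\}_q$; $(\uparrow;\downarrow\uparrow)$: $q^{-2i},1,0,1$; $(\downarrow;\downarrow\uparrow)$: $\{2i\}_qq^{-2j},\{2j\}_q,\{2k\}_q,0$; $(\downarrow;\downarrow\downarrow)$: $1,0,1,q^{-2i}$. * Vertex with one edge ($k$) above and two below ($i$ left, $j$ right); states (upper; lower left, lower right) $=(0;00),(0;11),(1;10),(1;01)$, directions (upper; left, right): $(\uparrow;\uparrow\uparrow)$: $1,0,1,q^{2i}$; $(\uparrow;\uparrow\downarrow)$: $\{2i\}_qq^{2j},\{2j\}_q,\{2k\}_q,0$; $(\downarrow;\uparrow\downarrow)$: $q^{2i},1,0,1$; $(\uparrow;\downarrow\uparrow)$: $\{2j\}_q,-\{2i\}_qq^{-2j},0,\{2k\}_q$; $(\downarrow;\downarrow\uparrow)$: $1,-q^{-2i},1,0$; $(\downarrow;\downarrow\downarrow)$: $\{2k\}_q,0,\{2i\}_qq^{2j},\{2j\}_q$. **Theorem.** The matrix of every cut diagram is a scalar matrix, so that $\underline\Delta$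 of it is given as above, and $\underline\Delta$ satisfies the following relations. The diagrams in one relation are cut at the same place and are identical outside of a disk, in which they are as described. Weights that are not mentioned are arbitrary subject to the admissibility conditions, and the relations hold whenever all diagrams in them are defined. An edge of multiplicity $0$ inside the disk that leaves one strand, of multiplicity $a$, and enters another is formally removed, and the diagram is then multiplied by $\{2a\}_q$ (provided that the remaining strands are consistently oriented and colored). (i) A circle of multiplicity $i$ has value $1/\{2i\}_q$. (ii) $(D)=0$ if the diagram $D$ is disconnected as a subset of the plane. (iii) A positive (negative) half twist on a strand of color $(i,I)$ can be removed at the cost of the factor $q^{-iI}$ (respectively $q^{iI}$). (iv) If a strand of multiplicity $i$ splits into two edges that merge again to the same strand, then the bigon can be replaced by the strand at the cost of the factor $\{2i\}_q$. (v) Let a left strand $j$ point upward and a right strand $i$ point downward. Let $S$ be the square with horizontal edges $i+j$, the lower one from left to right and the upper one from right to left, whose left side is $i$ pointing downward and whose right side is $j$ pointing upward. Let $X$ be the diagram in which the two lower ends meet at a vertex, the two upper ends meet at a vertex, and an edge $i-j$ runs down from the upper to the lower vertex. Then $(S)=\{2i+2j\}_q(X)+\{2j\}_q^2(\text{two vertical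 strands})$. (vi) For upward edges, splitting $i+j+k$ into $i+j$ and $k$ and then $i+j$ into $i,j$ equals $\frac{\{2i+2j\}_q}{\{2j+2k\}_q}$ times splitting $i+j+k$ into $i$ and $j+k$ and then $j+k$ into $j,k$. Merging $i,j$ and then $k$ equals merging $j,k$ and then $i$. (vii) For upward strands, with bottom ends $i,j$ and top ends $i+k-l,\ j+l-k$: let $L$ be the ladder with a lower rung $k$ from right to left and an upper rung $l$ from left to right, so that its sides between the rungs are $i+k$ and $j-k$; let $H$ be the diagram in which $i,j$ merge to $i+j$, which then splits; let $R$ be the diagram with a single rung $k-l$ from right to left. Then $$(L)=\frac{\{2j\}_q\{2l\}_q}{\{2j+2l-2k\}_q}(H)+\frac{\{2i+2k-2l\}_q\{2j-2k\}_q}{\{2j+2l-2k\}_q}(R).$$ (viii) Let $C_\pm$ be the crossing of upward strands, $(i,I)$ from bottom left to top right and $(j,J)$ from bottom right to top left, with $(i,I)$ over for $C_+$ and under for $C_-$. Among the upward diagrams with bottom ends $(i,I),(j,J)$ and top ends $(j,J),(i,I)$, let $H$ be the one in which the edges merge to $i+j$, which then splits, $R$ the one with a single rung $j-i$ from right to left,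 and $R'$ the one with a single rung $i-j$ from left to right. Then $$(C_+)=\tfrac{q^{i-j-iJ-jI}}{\{2i\}_q}(H)-\tfrac{q^{-i-j-iJ-jI}}{\{2i\}_q}(R)=\tfrac{q^{j-i-iJ-jI}}{\{2j\}_q}(H)-\tfrac{q^{-i-j-iJ-jI}}{\{2j\}_q}(R'),$$ $$(C_-)=\tfrac{q^{j-i+iJ+jI}}{\{2i\}_q}(H)-\tfrac{q^{i+j+iJ+jI}}{\{2i\}_q}(R)=\tfrac{q^{i-j+iJ+jI}}{\{2j\}_q}(H)-\tfrac{q^{i+j+iJ+jI}}{\{2j\}_q}(R').$$ -/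

import Mathlib

namespace Viro

/-! ### Scalars -/

/-- The indeterminate `q` in the field of rational functions. -/
noncomputable def q : RatFunc ℚ := RatFunc.X

/-- `{k}_q = q ^ k - q ^ (-k)`. -/
noncomputable def br (k : ℤ) : RatFunc ℚ := q ^ k - q ^ (-k)

/-! ### Diagrams in Morse position

A diagram in Morse position is cut by horizontal lines into slices.  It is read from the bottom
to the top, and points on a horizontal line are listed from left to right. -/

/-- A point where a coloured oriented edge crosses a horizontal line: `up` tells whether the edge
points upward there, `mult` is its multiplicity and `wt` is its weight. -/
@[ext] structure Pt where
  up : Bool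
  mult : ℤ
  wt : ℤ
deriving DecidableEq

/-- The same edge, crossed in the opposite direction. -/
def Pt.flip (x : Pt) : Pt := ⟨!x.up, x.mult, x.wt⟩

/-- An edge of colour `(i, I)` pointing upward. -/
def up (i I : ℤ) : Pt := ⟨true, i, I⟩

/-- An edge of colour `(i, I)` pointing downward. -/
def dn (i I : ℤ) : Pt := ⟨false, i, I⟩

/-- The elementary pieces.
* `cup x` is a local minimum and `cap x` is a local maximum, with left leg `x`;
* `twist p x` is a half twist of the framing, positive if `p = true`, negative if `p = false`;
* `cross o x y` is a crossing with bottom endpoints `x, y`; the strand from the bottom left to the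
  top right is the over-strand if `o = true` and the under-strand if `o = false`;
* `split k i j` is a vertex with the edge `k` below it and the edges `i, j` above it;
* `merge i j k` is a vertex with the edges `i, j` below it and the edge `k` above it. -/
inductive Piece where
  | cup (x : Pt)
  | cap (x : Pt)
  | twist (positive : Bool) (x : Pt)
  | cross (leftOver : Bool) (x y : Pt)
  | split (k i j : Pt)
  | merge (i j k : Pt)

/-- The endpoints at the bottom. -/
def Piece.src : Piece → List Pt
  | .cup _ => []
  | .cap x => [x, x.flip]
  | .twist _ x => [x]
  | .cross _ x y => [x, y]
  | .split k _ _ => [k]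
  | .merge i j _ => [i, j]

/-- The endpoints at the top. -/
def Piece.tgt : Piece → List Pt
  | .cup x => [x, x.flip]
  | .cap _ => []
  | .twist _ x => [x]
  | .cross _ x y => [y, x]
  | .split _ i j => [i, j]
  | .merge _ _ k => [k]

/-- The sign `ε` at a vertex of an edge attached from below: `-1` if it points toward the vertex
and `1` if it points away from it. -/
def Pt.signBelow (x : Pt) : ℤ := if x.up then -1 else 1

/-- The sign `ε` at a vertex of an edge attached from above. -/
def Pt.signAbove (x : Pt) : ℤ := if x.up then 1 else -1

/-- The conditions at a vertex with adjacent edges `x, y, z` and signs `a, b, c`: the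
multiplicities are nonzero, the two admissible conditions hold, and the vertex is neither a
source nor a sink. -/
def VertexValid (a b c : ℤ) (x y z : Pt) : Prop :=
  x.mult ≠ 0 ∧ y.mult ≠ 0 ∧ z.mult ≠ 0 ∧
  a * x.mult + b * y.mult + c * z.mult = 0 ∧
  a * x.wt + b * y.wt + c * z.wt = -(a * b * c) ∧
  ¬ (a = b ∧ b = c)

/-- The piece is correctly coloured and oriented. -/
def Piece.Valid : Piece → Prop
  | .cup x => x.mult ≠ 0
  | .cap x => x.mult ≠ 0
  | .twist _ x => x.mult ≠ 0
  | .cross _ x y => x.mult ≠ 0 ∧ y.mult ≠ 0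
  | .split k i j => VertexValid k.signBelow i.signAbove j.signAbove k i j
  | .merge i j k => VertexValid i.signBelow j.signBelow k.signAbove i j k

/-- A slice: one elementary piece with vertical segments to its left and to its right. -/
structure Slice where
  left : List Pt
  piece : Piece
  right : List Pt

def Slice.src (s : Slice) : List Pt := s.left ++ s.piece.src ++ s.right

def Slice.tgt (s : Slice) : List Pt := s.left ++ s.piece.tgt ++ s.right

/-- A stack of slices, listed from the bottom to the top. -/
abbrev Word := List Slice

/-- The slices fit together to a diagram with bottom endpoints `a` and top endpoints `b`. -/
def Word.Path : List Pt → Word → List Pt → Prop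
  | a, [], b => a = b
  | a, s :: W, b => a = s.src ∧ Word.Path s.tgt W b

/-- `W` is a coloured oriented diagram with bottom endpoints `a` and top endpoints `b`. -/
def Word.IsDiagram (a : List Pt) (W : Word) (b : List Pt) : Prop :=
  W.Path a b ∧ ∀ s ∈ W, s.piece.Valid

/-- Put vertical segments `l` to the left and `r` to the right of the diagram `W`. -/
def Word.whisker (l : List Pt) (W : Word) (r : List Pt) : Word :=
  W.map fun s => ⟨l ++ s.left, s.piece, s.right ++ r⟩

/-! ### Boltzmann weights

The state `false` of an edge is the boson `e₀`, and `true` is the fermion `e₁`. -/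

/-- Minima, with the state of their strand. -/
noncomputable def cupWeight (x : Pt) : Bool → RatFunc ℚ
  | false => if x.up then 1 else q ^ (-2 * x.mult)
  | true => if x.up then -q ^ (2 * x.mult) else 1

/-- Maxima, with the state of their strand. -/
noncomputable def capWeight (x : Pt) : Bool → RatFunc ℚ
  | false => if x.up then q ^ (2 * x.mult) else 1
  | true => if x.up then 1 else -q ^ (-2 * x.mult)

/-- Half twists. -/
noncomputable def twistWeight (positive : Bool) (x : Pt) : RatFunc ℚ :=
  if positive then q ^ (-(x.mult * x.wt)) else q ^ (x.mult * x.wt)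

/-- Crossings; the states are those of the bottom left, bottom right, top left and top right ends,
and `x`, `y` are the bottom left and the bottom right end.  The weights of the crossings with both
strands pointing upward determine the others, by rotating the crossing with a minimum and a
maximum, see `crossWeight_rotate`. -/
noncomputable def crossWeight (leftOver : Bool) (x y : Pt) : Bool → Bool → Bool → Bool → RatFunc ℚ :=
  let i := x.mult
  let j := y.mult
  let e := x.mult * y.wt + y.mult * x.wt
  let ε : ℤ := if leftOver = (x.up == y.up) then 1 else -1
  fun
  | false, false, false, false => q ^ (ε * (-e + i + j))
  | false, true, true, false => q ^ (ε * (-e + j - i))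
  | true, false, false, true => q ^ (ε * (-e + i - j))
  | true, true, true, true => -q ^ (ε * (-e - i - j))
  | false, true, false, true =>
    match leftOver, x.up, y.up with
    | true, true, true => (q ^ (4 * i) - 1) / q ^ (e + i + j)
    | false, false, false => -br (2 * j) * q ^ (e + i - j)
    | _, _, _ => 0
  | true, false, true, false =>
    match leftOver, x.up, y.up with
    | false, true, true => (1 - q ^ (4 * j)) / q ^ (-e + i + j)
    | true, false, false => br (2 * i) * q ^ (-e - i + j)
    | _, _, _ => 0
  | false, false, true, true =>
    match leftOver, x.up, y.up with
    | true, true, false => -br (2 * i) * q ^ (e + i + j)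
    | false, false, true => -br (2 * j) * q ^ (-e + i + j)
    | _, _, _ => 0
  | true, true, false, false =>
    match leftOver, x.up, y.up with
    | false, true, false => br (2 * j) * q ^ (-e - i - j)
    | true, false, true => br (2 * i) * q ^ (e - i - j)
    | _, _, _ => 0
  | _, _, _, _ => 0

/-- Distribute four weights over the states of the stem, the left leg and the right leg. -/
noncomputable def vertexWeight (c₀ c₁ c₂ c₃ : RatFunc ℚ) : Bool → Bool → Bool → RatFunc ℚ
  | false, false, false => c₀
  | false, true, true => c₁
  | true, true, false => c₂
  | true, false, true => c₃
  | _, _, _ => 0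

/-- Vertices with stem `x` below and legs `y` (left) and `z` (right) above; the states are those of
`x`, `y`, `z`. -/
noncomputable def splitWeight (x y z : Pt) : Bool → Bool → Bool → RatFunc ℚ :=
  let k := x.mult
  let i := y.mult
  let j := z.mult
  match x.up, y.up, z.up with
  | true, true, true =>
    vertexWeight (br (2 * k)) 0 (br (2 * i) * q ^ (-2 * j)) (br (2 * j))
  | true, true, false => vertexWeight 1 (-q ^ (2 * i)) 1 0
  | false, true, false =>
    vertexWeight (br (2 * j)) (-br (2 * i) * q ^ (2 * j)) 0 (br (2 * k))
  | true, false, true => vertexWeight (q ^ (-2 * i)) 1 0 1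
  | false, false, true =>
    vertexWeight (br (2 * i) * q ^ (-2 * j)) (br (2 * j)) (br (2 * k)) 0
  | false, false, false => vertexWeight 1 0 1 (q ^ (-2 * i))
  | _, _, _ => 0

/-- Vertices with legs `y` (left) and `z` (right) below and stem `x` above; the states are those of
`x`, `y`, `z`. -/
noncomputable def mergeWeight (y z x : Pt) : Bool → Bool → Bool → RatFunc ℚ :=
  let k := x.mult
  let i := y.mult
  let j := z.mult
  match x.up, y.up, z.up with
  | true, true, true => vertexWeight 1 0 1 (q ^ (2 * i))
  | true, true, false =>
    vertexWeight (br (2 * i) * q ^ (2 * j)) (br (2 * j)) (br (2 * k)) 0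
  | false, true, false => vertexWeight (q ^ (2 * i)) 1 0 1
  | true, false, true =>
    vertexWeight (br (2 * j)) (-br (2 * i) * q ^ (-2 * j)) 0 (br (2 * k))
  | false, false, true => vertexWeight 1 (-q ^ (-2 * i)) 1 0
  | false, false, false =>
    vertexWeight (br (2 * k)) 0 (br (2 * i) * q ^ (2 * j)) (br (2 * j))
  | _, _, _ => 0

/-- The Boltzmann weight of a piece, given the states at its bottom and at its top. -/
noncomputable def Piece.weight : Piece → List Bool → List Bool → RatFunc ℚ
  | .cup x, [], [s, t] => if s = t then cupWeight x s else 0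
  | .cap x, [s, t], [] => if s = t then capWeight x s else 0
  | .twist p x, [s], [t] => if s = t then twistWeight p x else 0
  | .cross o x y, [s, t], [u, v] => crossWeight o x y s t u v
  | .split k i j, [s], [t, u] => splitWeight k i j s t u
  | .merge i j k, [t, u], [s] => mergeWeight i j k s t u
  | _, _, _ => 0

/-- The matrix entry of a slice: the vertical segments keep their states. -/
noncomputable def Slice.weight (s : Slice) (b t : List Bool) : RatFunc ℚ :=
  let n := s.left.length
  let n₁ := s.piece.src.length
  let n₂ := s.piece.tgt.length
  if b.take n = t.take n ∧ b.drop (n + n₁) = t.drop (n + n₂) then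
    s.piece.weight ((b.drop n).take n₁) ((t.drop n).take n₂)
  else 0

/-- The matrix of the morphism of a diagram in the bases of tensor products of `e₀`'s and `e₁`'s:
the entry for the bottom states `b` and the top states `t`.  Stacking slices corresponds to
composition, so the states on every intermediate level are summed over. -/
noncomputable def Word.matrix : Word → List Bool → List Bool → RatFunc ℚ
  | [], b, t => if b = t then 1 else 0
  | s :: W, b, t =>
    ∑ m : Fin s.tgt.length → Bool, s.weight b (List.ofFn m) * Word.matrix W (List.ofFn m) t

/-- Rotating a crossing by a quarter turn. -/
theorem crossWeight_rotate (o : Bool) (x y : Pt) (b c t u : Bool) :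
    crossWeight o x y b c t u =
      cupWeight y t * crossWeight (!o) y.flip x t b u c * capWeight y.flip c := by
  have hq : q ≠ 0 := RatFunc.X_ne_zero
  obtain ⟨a, i, I⟩ := x
  obtain ⟨d, j, J⟩ := y
  cases b <;> cases c <;> cases t <;> cases u <;>
    dsimp only [crossWeight, cupWeight, capWeight, Pt.flip]
  all_goals try simp only [mul_zero, zero_mul]
  all_goals cases o <;> cases a <;> cases d <;> dsimp [br]
  all_goals try simp only [Bool.not_true, Bool.not_false, mul_zero, zero_mul]
  all_goals simp only [mul_sub, sub_mul, div_eq_mul_inv, one_mul, neg_mul, mul_neg, neg_neg,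
    neg_sub, mul_one, ← zpow_neg, ← zpow_add₀ hq]
  all_goals ring_nf

/-! ### The polynomial -/

/-- A graph diagram cut open: the diagram of a coloured framed graph is cut at a point of an edge
`x` on the boundary of the unbounded region, and is put in Morse position with the two endpoints
created by the cut at the bottom and at the top. -/
def IsCutDiagram (x : Pt) (W : Word) : Prop := x.mult ≠ 0 ∧ W.IsDiagram [x] [x]

/-- Viro's polynomial of a graph, computed from a diagram cut open at `x`: the morphism of the cut
diagram is the multiplication by a rational function, which is read off from `e₀ ↦ e₀` and divided
by `q ^ (2j) - q ^ (-2j)`. -/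
noncomputable def alexander (x : Pt) (W : Word) : RatFunc ℚ :=
  W.matrix [false] [false] / br (2 * x.mult)

/-- For a closed diagram which is the diagram `A` below a horizontal line, on which there are the
points `x :: w`, and `B` above it: cut the edge at the leftmost point `x`, bend the endpoint of `A`
down to the left of `A` and bend the endpoint of `B` up to the left of `B`. The result is cut open
at `x.flip`. -/
def cutLeft (A : Word) (x : Pt) (w : List Pt) (B : Word) : Word :=
  A.whisker [x.flip] [] ++ [⟨[], .cap x.flip, w⟩, ⟨[], .cup x.flip, w⟩] ++ B.whisker [x.flip] []

/-! ### Disconnected diagrams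

The point at position `p` (counted from the left, starting with `0`) of the horizontal line below
slice number `n` is denoted by `(n, p)`. -/

/-- `(n, p)` is a point of the diagram. -/
def Word.IsPoint (W : Word) (u : ℕ × ℕ) : Prop :=
  (∃ s, W[u.1]? = some s ∧ u.2 < s.src.length) ∨
  (∃ n s, u.1 = n + 1 ∧ W[n]? = some s ∧ u.2 < s.tgt.length)

/-- The two points are joined by a vertical segment of a slice or by an elementary piece (all ends of
a crossing are joined, as they are in the plane), or they are the two ends of the cut edge. -/
inductive Word.Joined (W : Word) : ℕ × ℕ → ℕ × ℕ → Prop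
  | left {n p : ℕ} {s : Slice} (hs : W[n]? = some s) (hp : p < s.left.length) :
      Joined W (n, p) (n + 1, p)
  | right {n p : ℕ} {s : Slice} (hs : W[n]? = some s) (hp : p < s.right.length) :
      Joined W (n, s.left.length + s.piece.src.length + p)
        (n + 1, s.left.length + s.piece.tgt.length + p)
  | bottom {n p p' : ℕ} {s : Slice} (hs : W[n]? = some s)
      (hp : p < s.piece.src.length) (hp' : p' < s.piece.src.length) :
      Joined W (n, s.left.length + p) (n, s.left.length + p')
  | top {n p p' : ℕ} {s : Slice} (hs : W[n]? = some s)
      (hp : p < s.piece.tgt.length) (hp' : p' < s.piece.tgt.length) :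
      Joined W (n + 1, s.left.length + p) (n + 1, s.left.length + p')
  | through {n p p' : ℕ} {s : Slice} (hs : W[n]? = some s)
      (hp : p < s.piece.src.length) (hp' : p' < s.piece.tgt.length) :
      Joined W (n, s.left.length + p) (n + 1, s.left.length + p')
  | cut : Joined W (0, 0) (W.length, 0)

/-- The diagram, as a subset of the plane, is disconnected. -/
def Word.Disconnected (W : Word) : Prop :=
  ∃ u v, W.IsPoint u ∧ W.IsPoint v ∧ ¬ Relation.EqvGen W.Joined u v

/-! ### Local relations -/

/-- The part of a cut diagram outside a disk in which a local diagram with bottom endpoints `a` and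
top endpoints `b` is to be placed. -/
structure Context (a b : List Pt) where
  base : Pt
  left : List Pt
  right : List Pt
  below : Word
  above : Word
  base_ne : base.mult ≠ 0
  below_diagram : below.IsDiagram [base] (left ++ a ++ right)
  above_diagram : above.IsDiagram (left ++ b ++ right) [base]

/-- A local diagram with a scalar in front of it.  The scalar differs from `1` only where a diagram
with an edge of multiplicity zero is formally defined as a multiple of the diagram without it. -/
structure Scaled where
  coeff : RatFunc ℚ
  word : Word

/-- The local diagram `D` can be placed in the context. -/
def Context.Admits {a b : List Pt} (_C : Context a b) (D : Scaled) : Prop := D.word.IsDiagram a b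

/-- Viro's polynomial of the diagram obtained by placing `D` in the context. -/
noncomputable def Context.value {a b : List Pt} (C : Context a b) (D : Scaled) : RatFunc ℚ :=
  D.coeff * alexander C.base (C.below ++ D.word.whisker C.left C.right ++ C.above)

/-- Vertical strands. -/
noncomputable def strands : Scaled := ⟨1, []⟩

/-- A half twist on a strand `x`. -/
noncomputable def twisted (positive : Bool) (x : Pt) : Scaled := ⟨1, [⟨[], .twist positive x, []⟩]⟩

/-- A crossing. -/
noncomputable def crossing (leftOver : Bool) (x y : Pt) : Scaled :=
  ⟨1, [⟨[], .cross leftOver x y, []⟩]⟩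

/-- The strand `x` splits into `y` and `z`, which merge again. -/
noncomputable def bigon (x y z : Pt) : Scaled :=
  if (y.mult = 0 ∧ z = x) ∨ (z.mult = 0 ∧ y = x) then ⟨br (2 * x.mult), []⟩
  else ⟨1, [⟨[], .split x y z, []⟩, ⟨[], .merge y z x, []⟩]⟩

/-- The edges `x, y` from below meet, are continued by `s`, and split into `x', y'`. -/
noncomputable def double (x y s x' y' : Pt) : Scaled :=
  ⟨1, [⟨[], .merge x y s, []⟩, ⟨[], .split s x' y', []⟩]⟩

/-- Two upward strands, from `x` to `x'` and from `y` to `y'`, with an edge `e` from the right strand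
to the left one. If `e` has multiplicity zero, the diagram is `{2j}_q` times the vertical strands,
where `j` is the multiplicity of the right strand. -/
noncomputable def rungLeft (x y e x' y' : Pt) : Scaled :=
  if e.mult = 0 then ⟨br (2 * y.mult), []⟩
  else ⟨1, [⟨[x], .split y e y', []⟩, ⟨[], .merge x e x', [y']⟩]⟩

/-- The same with an edge `e` from the left strand to the right one. -/
noncomputable def rungRight (x y e x' y' : Pt) : Scaled :=
  if e.mult = 0 then ⟨br (2 * x.mult), []⟩
  else ⟨1, [⟨[], .split x x' e, [y]⟩, ⟨[x'], .merge e y y', []⟩]⟩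

/-- `rungLeft x y k m n` with `rungRight m n l x' y'` on top of it. If the edge `n` between them has
multiplicity zero, the diagram is `{2j}_q` times the diagram without `n`, in which `y` runs into the
left strand as the edge `k` did and `y'` comes out of it as the edge `l` did; here `j` is the
multiplicity of `y`. -/
noncomputable def square (x y k m n l x' y' : Pt) : Scaled :=
  if n.mult = 0 then ⟨br (2 * y.mult), (double x y m x' y').word⟩
  else ⟨(rungLeft x y k m n).coeff * (rungRight m n l x' y').coeff,
    (rungLeft x y k m n).word ++ (rungRight m n l x' y').word⟩

/-- An upward strand `x` and a downward strand `y` joined by two horizontal edges: `s` runs from left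
to right at the bottom, `t` runs from right to left at the top, and between them the left strand is
`u`, pointing downward, and the right strand is `v`, pointing upward. -/
noncomputable def antiSquare (x y s t u v : Pt) : Scaled :=
  ⟨1, [⟨[], .split x u s, [y]⟩, ⟨[u], .merge s y v, []⟩,
    ⟨[u], .split v t y, []⟩, ⟨[], .merge u t x, [y]⟩]⟩

/-- An upward `x` and a downward `y` meet at the bottom and meet again at the top, and the two
vertices are joined by the edge `e`. If `e` has multiplicity zero, the diagram is `{2i}_q` times the
two arcs that remain, where `i` is the multiplicity of the upper arc. -/
noncomputable def antiDouble (x y e : Pt) : Scaled :=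
  if e.mult = 0 then ⟨br (2 * y.mult), [⟨[], .cap x, []⟩, ⟨[], .cup x, []⟩]⟩
  else ⟨1, [⟨[], .merge x y e, []⟩, ⟨[], .split e x y, []⟩]⟩

/-- The edge `t` from below splits into `r` and `c`, and then `r` splits into `a` and `b`. -/
noncomputable def splitLeft (t r a b c : Pt) : Scaled :=
  ⟨1, [⟨[], .split t r c, []⟩, ⟨[], .split r a b, [c]⟩]⟩

/-- The edge `t` from below splits into `a` and `r`, and then `r` splits into `b` and `c`. -/
noncomputable def splitRight (t r a b c : Pt) : Scaled :=
  ⟨1, [⟨[], .split t a r, []⟩, ⟨[a], .split r b c, []⟩]⟩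

/-- The edges `a` and `b` from below merge to `r`, and then `r` and `c` merge to `t`. -/
noncomputable def mergeLeft (t r a b c : Pt) : Scaled :=
  ⟨1, [⟨[], .merge a b r, [c]⟩, ⟨[], .merge r c t, []⟩]⟩

/-- The edges `b` and `c` from below merge to `r`, and then `a` and `r` merge to `t`. -/
noncomputable def mergeRight (t r a b c : Pt) : Scaled :=
  ⟨1, [⟨[a], .merge b c r, []⟩, ⟨[], .merge a r t, []⟩]⟩

end Viro

open Viro

set_option linter.unusedSimpArgs false

namespace Viro

/-! ### Sums over states -/

/-! The Boltzmann weights are matrix entries of intertwiners of the quantum supergroup of gl(1|1),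
and two of its elements suffice here. One is a grouplike element K, diagonal with the parity sign
included (`grade`). The other is an odd generator E (`charge`); on a tensor product it is the sum
over the points of E at that point, K at all points to its left and the identity to its right. Every
valid piece commutes with K and E (`Piece.gradeComm`, `Piece.chargeComm`), hence every diagram does.
On one strand K takes opposite values on the two states, so the matrix of a cut diagram is diagonal;
E is a single off-diagonal matrix unit, so the two diagonal entries agree.

For a disconnected diagram, let E act only on the points of a component that misses the cut, while K
still acts at all points. Each piece lies in one component, so this partial E still commutes with
all slices. It is zero at both ends of the diagram, but at a level that meets the component it is
contractible: EY + YE = 1 for some Y (`exists_homotopy`). If the diagram is A followed by B at that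
level, then AB = A(EY + YE)B = 0, because AE = 0 and EB = 0 (`sum_eq_zero_of_chargeComm`).

The local relations rest on linearity: the polynomial is a linear functional of the matrix of the
diagram in the disk (`Context.value_eq_eval`), so a linear relation between local matrices holds in
every context. What remains is a finite list of identities between Laurent polynomials in `q`, one
for each choice of boundary states, with separate cases where an edge has multiplicity zero. -/

theorem q_ne_zero : q ≠ 0 := RatFunc.X_ne_zero

/-- The lists of `n` states. -/
def states (n : ℕ) : Finset (List Bool) :=
  (Finset.univ : Finset (Fin n → Bool)).map ⟨List.ofFn, List.ofFn_injective⟩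

theorem mem_states {n : ℕ} {l : List Bool} : l ∈ states n ↔ l.length = n := by
  simp only [states, Finset.mem_map, Finset.mem_univ, true_and, Function.Embedding.coeFn_mk]
  constructor
  · rintro ⟨f, rfl⟩
    simp
  · rintro rfl
    exact ⟨l.get, List.ofFn_get l⟩

theorem sum_ofFn (n : ℕ) (f : List Bool → RatFunc ℚ) :
    ∑ m : Fin n → Bool, f (List.ofFn m) = ∑ m ∈ states n, f m := by
  simp [states]

theorem sum_states_zero (f : List Bool → RatFunc ℚ) : ∑ m ∈ states 0, f m = f [] := by
  rw [← sum_ofFn]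
  simp

theorem sum_states_add (a b : ℕ) (f : List Bool → RatFunc ℚ) :
    ∑ m ∈ states (a + b), f m = ∑ u ∈ states a, ∑ v ∈ states b, f (u ++ v) := by
  rw [← Finset.sum_product']
  symm
  refine Finset.sum_bij' (fun p _ => p.1 ++ p.2) (fun m _ => (m.take a, m.drop a)) ?_ ?_ ?_ ?_ ?_
  · rintro ⟨u, v⟩ h
    simp only [Finset.mem_product, mem_states] at h
    simp [mem_states, h]
  · intro m h
    simp only [mem_states] at h
    simp [mem_states, h]
  · rintro ⟨u, v⟩ h
    simp only [Finset.mem_product, mem_states] at h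
    simp [← h.1]
  · intro m _
    simp
  · intros
    rfl

theorem sum_states_one (f : List Bool → RatFunc ℚ) :
    ∑ m ∈ states 1, f m = f [false] + f [true] := by
  have h : states 1 = {[false], [true]} := by
    ext l
    rw [mem_states, List.length_eq_one_iff]
    constructor
    · rintro ⟨_ | _, rfl⟩ <;> simp
    · intro h
      simp only [Finset.mem_insert, Finset.mem_singleton] at h
      rcases h with rfl | rfl <;> simp
  rw [h, Finset.sum_pair (by simp)]

theorem sum_states_succ (n : ℕ) (f : List Bool → RatFunc ℚ) :
    ∑ m ∈ states (n + 1), f m =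
      ∑ m ∈ states n, f (false :: m) + ∑ m ∈ states n, f (true :: m) := by
  rw [add_comm n 1, sum_states_add, sum_states_one]
  rfl

theorem sum_states_two (f : List Bool → RatFunc ℚ) :
    ∑ m ∈ states 2, f m =
      f [false, false] + f [false, true] + (f [true, false] + f [true, true]) := by
  simp only [sum_states_succ, sum_states_zero]

theorem sum_states_eq {n : ℕ} {l : List Bool} (h : l.length = n) (f : List Bool → RatFunc ℚ) :
    ∑ m ∈ states n, (if l = m then f m else 0) = f l := by
  rw [Finset.sum_ite_eq, if_pos (mem_states.2 h)]

theorem sum_states_eq' {n : ℕ} {l : List Bool} (h : l.length = n) (f : List Bool → RatFunc ℚ) :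
    ∑ m ∈ states n, (if m = l then f m else 0) = f l := by
  rw [Finset.sum_ite_eq', if_pos (mem_states.2 h)]

theorem ite_sum_zero (p : Prop) [Decidable p] (s : Finset (List Bool))
    (f : List Bool → RatFunc ℚ) :
    (if p then ∑ m ∈ s, f m else 0) = ∑ m ∈ s, if p then f m else 0 := by
  split_ifs <;> simp

theorem exists_append_of_length {a b : ℕ} {l : List Bool} (h : l.length = a + b) :
    ∃ u v, u.length = a ∧ v.length = b ∧ l = u ++ v :=
  ⟨l.take a, l.drop a, by simp [h], by simp [h], by simp⟩

/-! ### Matrices of words -/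

theorem Slice.weight_append (s : Slice) {b₁ b₂ b₃ t₁ t₂ t₃ : List Bool}
    (hb₁ : b₁.length = s.left.length) (ht₁ : t₁.length = s.left.length)
    (hb₂ : b₂.length = s.piece.src.length) (ht₂ : t₂.length = s.piece.tgt.length) :
    s.weight (b₁ ++ b₂ ++ b₃) (t₁ ++ t₂ ++ t₃) =
      if b₁ = t₁ ∧ b₃ = t₃ then s.piece.weight b₂ t₂ else 0 := by
  have e₁ : (b₁ ++ b₂ ++ b₃).take s.left.length = b₁ := by simp [← hb₁]
  have e₂ : (t₁ ++ t₂ ++ t₃).take s.left.length = t₁ := by simp [← ht₁]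
  have e₃ : (b₁ ++ b₂ ++ b₃).drop (s.left.length + s.piece.src.length) = b₃ := by
    rw [← hb₁, ← hb₂, ← List.length_append, List.drop_left]
  have e₄ : (t₁ ++ t₂ ++ t₃).drop (s.left.length + s.piece.tgt.length) = t₃ := by
    rw [← ht₁, ← ht₂, ← List.length_append, List.drop_left]
  have e₅ : ((b₁ ++ b₂ ++ b₃).drop s.left.length).take s.piece.src.length = b₂ := by
    rw [List.append_assoc, ← hb₁, List.drop_left, ← hb₂, List.take_left]
  have e₆ : ((t₁ ++ t₂ ++ t₃).drop s.left.length).take s.piece.tgt.length = t₂ := by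
    rw [List.append_assoc, ← ht₁, List.drop_left, ← ht₂, List.take_left]
  simp only [Slice.weight, e₁, e₂, e₃, e₄, e₅, e₆]

theorem Slice.length_src (s : Slice) :
    s.src.length = s.left.length + s.piece.src.length + s.right.length := by
  simp only [Slice.src, List.length_append]

theorem Slice.length_tgt (s : Slice) :
    s.tgt.length = s.left.length + s.piece.tgt.length + s.right.length := by
  simp only [Slice.tgt, List.length_append]

/-- Vertical segments keep their states, so the sums over the two outer blocks are Kronecker deltas
and only the states of the piece survive. -/
theorem Slice.sum_tgt (s : Slice) {b₁ b₂ b₃ : List Bool} (f : List Bool → RatFunc ℚ)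
    (hb₁ : b₁.length = s.left.length) (hb₂ : b₂.length = s.piece.src.length)
    (hb₃ : b₃.length = s.right.length) :
    ∑ m ∈ states s.tgt.length, s.weight (b₁ ++ b₂ ++ b₃) m * f m =
      ∑ m ∈ states s.piece.tgt.length, s.piece.weight b₂ m * f (b₁ ++ m ++ b₃) := by
  rw [s.length_tgt, sum_states_add, sum_states_add,
    ← sum_states_eq hb₁ fun u => ∑ m ∈ states _, s.piece.weight b₂ m * f (u ++ m ++ b₃)]
  refine Finset.sum_congr rfl fun u hu => ?_
  rw [ite_sum_zero]
  refine Finset.sum_congr rfl fun v hv => ?_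
  rw [← sum_states_eq hb₃ fun w => s.piece.weight b₂ v * f (u ++ v ++ w), ite_sum_zero]
  refine Finset.sum_congr rfl fun w _ => ?_
  rw [s.weight_append hb₁ (mem_states.1 hu) hb₂ (mem_states.1 hv)]
  by_cases h₁ : b₁ = u <;> by_cases h₃ : b₃ = w <;> simp [h₁, h₃]

theorem Slice.sum_src (s : Slice) {t₁ t₂ t₃ : List Bool} (f : List Bool → RatFunc ℚ)
    (ht₁ : t₁.length = s.left.length) (ht₂ : t₂.length = s.piece.tgt.length)
    (ht₃ : t₃.length = s.right.length) :
    ∑ m ∈ states s.src.length, f m * s.weight m (t₁ ++ t₂ ++ t₃) =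
      ∑ m ∈ states s.piece.src.length, f (t₁ ++ m ++ t₃) * s.piece.weight m t₂ := by
  rw [s.length_src, sum_states_add, sum_states_add,
    ← sum_states_eq' ht₁ fun u => ∑ m ∈ states _, f (u ++ m ++ t₃) * s.piece.weight m t₂]
  refine Finset.sum_congr rfl fun u hu => ?_
  rw [ite_sum_zero]
  refine Finset.sum_congr rfl fun v hv => ?_
  rw [← sum_states_eq' ht₃ fun w => f (u ++ v ++ w) * s.piece.weight v t₂, ite_sum_zero]
  refine Finset.sum_congr rfl fun w _ => ?_
  rw [s.weight_append (mem_states.1 hu) ht₁ (mem_states.1 hv) ht₂]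
  by_cases h₁ : u = t₁ <;> by_cases h₃ : w = t₃ <;> simp [h₁, h₃]

theorem Word.matrix_cons (s : Slice) (W : Word) (b t : List Bool) :
    Word.matrix (s :: W) b t =
      ∑ m ∈ states s.tgt.length, s.weight b m * Word.matrix W m t := by
  rw [Word.matrix, sum_ofFn s.tgt.length fun m => s.weight b m * Word.matrix W m t]

theorem Word.matrix_cons_append (s : Slice) (W : Word) {b₁ b₂ b₃ : List Bool} (t : List Bool)
    (hb₁ : b₁.length = s.left.length) (hb₂ : b₂.length = s.piece.src.length)
    (hb₃ : b₃.length = s.right.length) :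
    Word.matrix (s :: W) (b₁ ++ b₂ ++ b₃) t =
      ∑ m ∈ states s.piece.tgt.length,
        s.piece.weight b₂ m * Word.matrix W (b₁ ++ m ++ b₃) t := by
  rw [Word.matrix_cons, s.sum_tgt _ hb₁ hb₂ hb₃]

theorem Word.matrix_append {a c : List Pt} {W₁ : Word} (h : W₁.Path a c) (W₂ : Word)
    {b : List Bool} (hb : b.length = a.length) (t : List Bool) :
    Word.matrix (W₁ ++ W₂) b t =
      ∑ m ∈ states c.length, Word.matrix W₁ b m * Word.matrix W₂ m t := by
  induction W₁ generalizing a b with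
  | nil =>
    obtain rfl : a = c := h
    simp [Word.matrix, mem_states, hb]
  | cons s W ih =>
    obtain ⟨rfl, h⟩ := h
    rw [List.cons_append, Word.matrix_cons]
    simp only [Word.matrix_cons s W, Finset.sum_mul]
    rw [Finset.sum_comm]
    refine Finset.sum_congr rfl fun m hm => ?_
    rw [ih h (mem_states.1 hm), Finset.mul_sum]
    simp only [mul_assoc]

theorem Word.path_append {a b c : List Pt} {W₁ W₂ : Word} (h₁ : W₁.Path a b) (h₂ : W₂.Path b c) :
    Word.Path a (W₁ ++ W₂) c := by
  induction W₁ generalizing a with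
  | nil =>
    obtain rfl : a = b := h₁
    exact h₂
  | cons s W ih => exact ⟨h₁.1, ih h₁.2⟩

theorem Word.path_whisker {a b : List Pt} {W : Word} (h : W.Path a b) (l r : List Pt) :
    Word.Path (l ++ a ++ r) (W.whisker l r) (l ++ b ++ r) := by
  induction W generalizing a with
  | nil =>
    obtain rfl : a = b := h
    rfl
  | cons s W ih =>
    obtain ⟨rfl, h⟩ := h
    refine ⟨by simp [Slice.src], ?_⟩
    have := ih h
    simpa [Slice.tgt, Word.whisker] using this

/-- This is the locality that allows a relation in a disk to be checked on the matrix of the disk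
alone. -/
theorem Word.matrix_whisker {a b : List Pt} {W : Word} (h : W.Path a b) (l r : List Pt)
    {b₁ b₂ b₃ t₁ t₂ t₃ : List Bool}
    (hb₁ : b₁.length = l.length) (ht₁ : t₁.length = l.length)
    (hb₂ : b₂.length = a.length) (ht₂ : t₂.length = b.length)
    (hb₃ : b₃.length = r.length) :
    Word.matrix (W.whisker l r) (b₁ ++ b₂ ++ b₃) (t₁ ++ t₂ ++ t₃) =
      if b₁ = t₁ ∧ b₃ = t₃ then Word.matrix W b₂ t₂ else 0 := by
  induction W generalizing a b₂ with
  | nil =>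
    obtain rfl : a = b := h
    have : b₁ ++ b₂ ++ b₃ = t₁ ++ t₂ ++ t₃ ↔ (b₁ = t₁ ∧ b₃ = t₃) ∧ b₂ = t₂ := by
      constructor
      · intro h
        obtain ⟨h, h₃⟩ := List.append_inj h (by simp [*])
        obtain ⟨h₁, h₂⟩ := List.append_inj h (by simp [*])
        exact ⟨⟨h₁, h₃⟩, h₂⟩
      · rintro ⟨⟨rfl, rfl⟩, rfl⟩
        rfl
    simp only [Word.whisker, List.map_nil, Word.matrix, this, ite_and]
  | cons s W ih =>
    obtain ⟨rfl, h⟩ := h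
    obtain ⟨_, w, huv, hw, rfl⟩ := exists_append_of_length (hb₂.trans s.length_src)
    obtain ⟨u, v, hu, hv, rfl⟩ := exists_append_of_length huv
    -- The added strands are absorbed into the vertical segments of the first slice.
    have e : b₁ ++ (u ++ v ++ w) ++ b₃ = (b₁ ++ u) ++ v ++ (w ++ b₃) := by simp
    rw [e, Word.whisker, List.map_cons, Word.matrix_cons_append ⟨l ++ s.left, s.piece, s.right ++ r⟩
      _ _ (by simp [*]) hv (by simp [*]), Word.matrix_cons_append s _ _ hu hv hw]
    rw [ite_sum_zero]
    refine Finset.sum_congr rfl fun m hm => ?_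
    rw [mem_states] at hm
    have e : b₁ ++ u ++ m ++ (w ++ b₃) = b₁ ++ (u ++ m ++ w) ++ b₃ := by simp
    have := ih h (b₂ := u ++ m ++ w) (by simp [Slice.tgt, *])
    rw [e]
    simp only [Word.whisker] at this
    rw [this]
    split_ifs <;> simp

/-! ### The supercharge -/

/-- The action of the grouplike element, together with the sign of the parity. -/
noncomputable def grade (x : Pt) (b : Bool) : RatFunc ℚ :=
  (if b then -1 else 1) * (if x.up then q ^ (2 * x.mult) else q ^ (-2 * x.mult))

/-- The action of the grouplike element on a tensor product. -/
noncomputable def gradeProd : List Pt → List Bool → RatFunc ℚ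
  | x :: L, b :: B => grade x b * gradeProd L B
  | _, _ => 1

/-- The matrix of the odd generator, acting only on the marked points. -/
noncomputable def charge : List (Pt × Bool) → List Bool → List Bool → RatFunc ℚ
  | x :: L, b :: B, t :: T =>
    (if x.2 = true ∧ b = x.1.up ∧ t = !b ∧ B = T then 1 else 0) +
      if b = t then grade x.1 b * charge L B T else 0
  | _, _, _ => 0

/-- All points are marked by the same mark. -/
def mark (c : Bool) (L : List Pt) : List (Pt × Bool) := L.map fun x => (x, c)

theorem grade_ne_zero (x : Pt) (b : Bool) : grade x b ≠ 0 := by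
  have := q_ne_zero
  unfold grade
  cases b <;> split_ifs <;> simp [zpow_ne_zero, this]

/-- The parity sign makes K anticommute with every flip of a state. The vanishing of off-diagonal
entries and the homotopy both rest on this. -/
theorem grade_not (x : Pt) (b : Bool) : grade x (!b) = -grade x b := by
  cases b <;> simp only [grade, Bool.not_false, Bool.not_true, if_true, Bool.false_eq_true,
    if_false] <;> ring

theorem gradeProd_append (L₁ L₂ : List Pt) {b₁ : List Bool} (h : b₁.length = L₁.length)
    (b₂ : List Bool) :
    gradeProd (L₁ ++ L₂) (b₁ ++ b₂) = gradeProd L₁ b₁ * gradeProd L₂ b₂ := by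
  induction L₁ generalizing b₁ with
  | nil =>
    obtain rfl := List.length_eq_zero_iff.1 h
    simp [gradeProd]
  | cons x L ih =>
    cases b₁ with
    | nil => simp at h
    | cons b B =>
      simp only [List.cons_append, gradeProd, ih (by simpa using h), mul_assoc]

/-- The coproduct E ⊗ 1 + K ⊗ E, for blocks of points. The factor K ignores the marks: an unmarked
point on the left still contributes its grade. -/
theorem charge_append (L₁ L₂ : List (Pt × Bool)) {b₁ t₁ : List Bool}
    (hb : b₁.length = L₁.length) (ht : t₁.length = L₁.length) (b₂ t₂ : List Bool) :
    charge (L₁ ++ L₂) (b₁ ++ b₂) (t₁ ++ t₂) =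
      (if b₂ = t₂ then charge L₁ b₁ t₁ else 0) +
        if b₁ = t₁ then gradeProd (L₁.map Prod.fst) b₁ * charge L₂ b₂ t₂ else 0 := by
  induction L₁ generalizing b₁ t₁ with
  | nil =>
    obtain rfl := List.length_eq_zero_iff.1 hb
    obtain rfl := List.length_eq_zero_iff.1 ht
    simp [gradeProd, charge]
  | cons x L ih =>
    cases b₁ with
    | nil => simp at hb
    | cons b B =>
      cases t₁ with
      | nil => simp at ht
      | cons t T =>
        have hb' : B.length = L.length := by simpa using hb
        have ht' : T.length = L.length := by simpa using ht
        have e : B ++ b₂ = T ++ t₂ ↔ B = T ∧ b₂ = t₂ :=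
          ⟨fun h => List.append_inj h (hb'.trans ht'.symm), fun h => by rw [h.1, h.2]⟩
        simp only [List.cons_append, charge, ih hb' ht', e, List.map_cons, gradeProd,
          List.cons.injEq]
        by_cases h₁ : b₂ = t₂ <;> by_cases h₂ : b = t <;> by_cases h₃ : B = T <;>
          simp [h₁, h₂, h₃, mul_add, mul_assoc]

theorem charge_mark_false (L : List Pt) (b t : List Bool) : charge (mark false L) b t = 0 := by
  induction L generalizing b t with
  | nil => rfl
  | cons x L ih =>
    cases b with
    | nil => rfl
    | cons b B =>
      cases t with
      | nil => rfl
      | cons t T =>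
        have := ih B T
        unfold mark at this
        simp [mark, charge, this]

/-- Where a point is marked, the odd generator is contractible. -/
theorem exists_homotopy (L : List (Pt × Bool)) (h : ∃ x ∈ L, x.2 = true) :
    ∃ Y : List Bool → List Bool → RatFunc ℚ, ∀ b ∈ states L.length, ∀ t ∈ states L.length,
      ∑ m ∈ states L.length, (charge L b m * Y m t + Y b m * charge L m t) =
        if b = t then 1 else 0 := by
  induction L with
  | nil => simp at h
  | cons x L ih =>
    obtain ⟨x, c⟩ := x
    cases c with
    | false =>
      obtain ⟨Y, hY⟩ := ih (by simpa using h)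
      -- If the first point is unmarked, E is K ⊗ E' with E' the action on the tail, so K⁻¹ ⊗ Y' is
      -- a homotopy whenever Y' is one for E'.
      refine ⟨fun b t => match b, t with
        | b :: B, t :: T => if b = t then (grade x b)⁻¹ * Y B T else 0
        | _, _ => 0, fun b hb t ht => ?_⟩
      rw [mem_states] at hb ht
      cases b with
      | nil => simp at hb
      | cons b B =>
        cases t with
        | nil => simp at ht
        | cons t T =>
          have hB := hY B (mem_states.2 (by simpa using hb)) T (mem_states.2 (by simpa using ht))
          have g (c : Bool) (u v : RatFunc ℚ) : grade x c * u * ((grade x c)⁻¹ * v) = u * v := by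
            field_simp [grade_ne_zero x c]
          have g' (c : Bool) (u v : RatFunc ℚ) : (grade x c)⁻¹ * u * (grade x c * v) = u * v := by
            field_simp [grade_ne_zero x c]
          rw [List.length_cons, sum_states_succ]
          cases b <;> cases t <;> simp [charge, g, g', hB]
    | true =>
      -- If the first point is marked, E is e ⊗ 1 + K ⊗ E' with e a matrix unit. Take Y to be the
      -- transpose of e on this point and the identity on the tail: e and its transpose have
      -- anticommutator 1, and the terms with K cancel because K anticommutes with a flip. The tail
      -- needs no homotopy.
      refine ⟨fun b t => match b, t with
        | b :: B, t :: T => if b = (!x.up) ∧ t = x.up ∧ B = T then 1 else 0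
        | _, _ => 0, fun b hb t ht => ?_⟩
      rw [mem_states] at hb ht
      cases b with
      | nil => simp at hb
      | cons b B =>
        cases t with
        | nil => simp at ht
        | cons t T =>
          have hB : B ∈ states L.length := mem_states.2 (by simpa using hb)
          have hT : T ∈ states L.length := mem_states.2 (by simpa using ht)
          have e₁ := grade_not x true
          simp only [Bool.not_true] at e₁
          rw [List.length_cons, sum_states_succ]
          simp only [charge]
          cases hx : x.up <;> cases b <;> cases t <;>
            simp [e₁, hB, hT]

/-! ### Intertwining -/

/-- The matrix `A` commutes with the grouplike element. -/
def GradeComm (a c : List Pt) (A : List Bool → List Bool → RatFunc ℚ) : Prop :=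
  ∀ b ∈ states a.length, ∀ t ∈ states c.length, gradeProd a b * A b t = A b t * gradeProd c t

/-- The matrix `A` commutes with the odd generator. -/
def ChargeComm (a c : List (Pt × Bool)) (A : List Bool → List Bool → RatFunc ℚ) : Prop :=
  ∀ b ∈ states a.length, ∀ t ∈ states c.length,
    ∑ m ∈ states c.length, A b m * charge c m t = ∑ m ∈ states a.length, charge a b m * A m t

theorem Slice.gradeComm (s : Slice) (h : GradeComm s.piece.src s.piece.tgt s.piece.weight) :
    GradeComm s.src s.tgt s.weight := by
  intro b hb t ht
  rw [mem_states] at hb ht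
  obtain ⟨_, b₃, huv, hb₃, rfl⟩ := exists_append_of_length (hb.trans s.length_src)
  obtain ⟨b₁, b₂, hb₁, hb₂, rfl⟩ := exists_append_of_length huv
  obtain ⟨_, t₃, huv', ht₃, rfl⟩ := exists_append_of_length (ht.trans s.length_tgt)
  obtain ⟨t₁, t₂, ht₁, ht₂, rfl⟩ := exists_append_of_length huv'
  rw [s.weight_append hb₁ ht₁ hb₂ ht₂]
  split_ifs with h'
  · obtain ⟨rfl, rfl⟩ := h'
    rw [Slice.src, Slice.tgt, gradeProd_append _ _ (by simp [*]), gradeProd_append _ _ hb₁,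
      gradeProd_append _ _ (by simp [*]), gradeProd_append _ _ hb₁]
    linear_combination (gradeProd s.left b₁ * gradeProd s.right b₃) *
      h b₂ (mem_states.2 hb₂) t₂ (mem_states.2 ht₂)
  · simp

theorem map_fst_mark (c : Bool) (L : List Pt) : (mark c L).map Prod.fst = L := by
  simp [mark, Function.comp_def]

theorem length_mark (c : Bool) (L : List Pt) : (mark c L).length = L.length := by
  simp [mark]

/-- E has a part on the left, a part on the piece and a part on the right. The first commutes with
the piece trivially, the second by `h`; in the third K acts on the piece, which is where `hg`
enters. The marks of the outer points are arbitrary. -/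
theorem Slice.chargeComm (s : Slice) {l r : List (Pt × Bool)} {p p' : Bool}
    (hl : l.map Prod.fst = s.left) (hr : r.map Prod.fst = s.right)
    (hg : GradeComm s.piece.src s.piece.tgt s.piece.weight)
    (h : ChargeComm (mark p s.piece.src) (mark p' s.piece.tgt) s.piece.weight) :
    ChargeComm (l ++ mark p s.piece.src ++ r) (l ++ mark p' s.piece.tgt ++ r) s.weight := by
  have hl' : l.length = s.left.length := by rw [← hl, List.length_map]
  have hr' : r.length = s.right.length := by rw [← hr, List.length_map]
  have es : (l ++ mark p s.piece.src ++ r).length = s.src.length := by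
    rw [s.length_src, List.length_append, List.length_append, length_mark, hl', hr']
  have et : (l ++ mark p' s.piece.tgt ++ r).length = s.tgt.length := by
    rw [s.length_tgt, List.length_append, List.length_append, length_mark, hl', hr']
  intro b hb t ht
  rw [mem_states] at hb ht
  rw [es] at hb ⊢
  rw [et] at ht ⊢
  obtain ⟨_, b₃, huv, hb₃, rfl⟩ := exists_append_of_length (hb.trans s.length_src)
  obtain ⟨b₁, b₂, hb₁, hb₂, rfl⟩ := exists_append_of_length huv
  obtain ⟨_, t₃, huv', ht₃, rfl⟩ := exists_append_of_length (ht.trans s.length_tgt)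
  obtain ⟨t₁, t₂, ht₁, ht₂, rfl⟩ := exists_append_of_length huv'
  rw [s.sum_tgt _ hb₁ hb₂ hb₃, s.sum_src _ ht₁ ht₂ ht₃]
  have h := h b₂ (mem_states.2 (by rwa [length_mark])) t₂ (mem_states.2 (by rwa [length_mark]))
  have hg := hg b₂ (mem_states.2 hb₂) t₂ (mem_states.2 ht₂)
  rw [length_mark, length_mark] at h
  -- The three parts of E, from two applications of the coproduct formula.
  have key (c : Bool) (P : List Pt) (u v : List Bool) (hu : u.length = P.length)
      (hv : v.length = P.length) :
      charge (l ++ mark c P ++ r) (b₁ ++ u ++ b₃) (t₁ ++ v ++ t₃) =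
        (if b₃ = t₃ then (if u = v then charge l b₁ t₁ else 0) +
          if b₁ = t₁ then gradeProd s.left b₁ * charge (mark c P) u v else 0 else 0) +
        if b₁ = t₁ then if u = v then
          gradeProd s.left b₁ * gradeProd P u * charge r b₃ t₃ else 0 else 0 := by
    have e : b₁ ++ u = t₁ ++ v ↔ b₁ = t₁ ∧ u = v :=
      ⟨fun h => List.append_inj h (by simp [*]), fun h => by rw [h.1, h.2]⟩
    rw [charge_append _ _ (by simp [*, length_mark]) (by simp [*, length_mark]),
      charge_append _ _ (by simp [*]) (by simp [*]), List.map_append, map_fst_mark,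
      hl, gradeProd_append _ _ hb₁]
    simp only [e, ite_and]
  have e₁ : ∑ m ∈ states s.piece.tgt.length, s.piece.weight b₂ m *
      charge (l ++ mark p' s.piece.tgt ++ r) (b₁ ++ m ++ b₃) (t₁ ++ t₂ ++ t₃) =
      (if b₃ = t₃ then s.piece.weight b₂ t₂ * charge l b₁ t₁ +
        if b₁ = t₁ then gradeProd s.left b₁ * ∑ m ∈ states s.piece.tgt.length,
          s.piece.weight b₂ m * charge (mark p' s.piece.tgt) m t₂ else 0 else 0) +
      if b₁ = t₁ then gradeProd s.left b₁ * (s.piece.weight b₂ t₂ * gradeProd s.piece.tgt t₂) *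
        charge r b₃ t₃ else 0 := by
    rw [Finset.sum_congr rfl fun m hm => by rw [key _ _ _ _ (mem_states.1 hm) ht₂]]
    by_cases h₁ : b₁ = t₁ <;> by_cases h₃ : b₃ = t₃ <;>
      simp [h₁, h₃, mul_add, Finset.sum_add_distrib, Finset.mul_sum, mem_states.2 ht₂] <;>
      simp only [mul_left_comm, mul_assoc]
  have e₂ : ∑ m ∈ states s.piece.src.length,
      charge (l ++ mark p s.piece.src ++ r) (b₁ ++ b₂ ++ b₃) (t₁ ++ m ++ t₃) *
        s.piece.weight m t₂ =
      (if b₃ = t₃ then s.piece.weight b₂ t₂ * charge l b₁ t₁ +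
        if b₁ = t₁ then gradeProd s.left b₁ * ∑ m ∈ states s.piece.src.length,
          charge (mark p s.piece.src) b₂ m * s.piece.weight m t₂ else 0 else 0) +
      if b₁ = t₁ then gradeProd s.left b₁ * (gradeProd s.piece.src b₂ * s.piece.weight b₂ t₂) *
        charge r b₃ t₃ else 0 := by
    rw [Finset.sum_congr rfl fun m hm => by rw [key _ _ _ _ hb₂ (mem_states.1 hm)]]
    by_cases h₁ : b₁ = t₁ <;> by_cases h₃ : b₃ = t₃ <;>
      simp [h₁, h₃, add_mul, Finset.sum_add_distrib, Finset.mul_sum, mem_states.2 hb₂, mul_comm] <;>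
      simp only [mul_assoc]
  rw [e₁, e₂, h, hg]

theorem GradeComm.matrix {a c : List Pt} {W : Word} (h : W.Path a c)
    (hW : ∀ s ∈ W, GradeComm s.src s.tgt s.weight) : GradeComm a c W.matrix := by
  induction W generalizing a with
  | nil =>
    obtain rfl : a = c := h
    intro b _ t _
    by_cases h : b = t <;> simp [Word.matrix, h]
  | cons s W ih =>
    obtain ⟨rfl, h⟩ := h
    intro b hb t ht
    have ih := ih h fun s hs => hW s (List.mem_cons_of_mem _ hs)
    have hs := hW s List.mem_cons_self
    rw [Word.matrix_cons, Finset.mul_sum, Finset.sum_mul]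
    refine Finset.sum_congr rfl fun m hm => ?_
    linear_combination Word.matrix W m t * hs b hb m hm + s.weight b m * ih m hm t ht

/-- The levels of a word can be marked in such a way that each slice commutes with the odd
generator. -/
def ChargePath : List (Pt × Bool) → Word → List (Pt × Bool) → Prop
  | a, [], b => a = b
  | a, s :: W, b => a.map Prod.fst = s.src ∧
    ∃ c : List (Pt × Bool), c.map Prod.fst = s.tgt ∧ ChargeComm a c s.weight ∧ ChargePath c W b

theorem ChargePath.chargeComm {a c : List (Pt × Bool)} {W : Word} (h : ChargePath a W c) :
    ChargeComm a c W.matrix := by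
  induction W generalizing a with
  | nil =>
    obtain rfl : a = c := h
    intro b hb t ht
    simp [Word.matrix, hb, ht]
  | cons s W ih =>
    obtain ⟨ha, c', hc', hs, h⟩ := h
    have ih := ih h
    have hl : c'.length = s.tgt.length := by rw [← hc', List.length_map]
    intro b hb t ht
    simp only [Word.matrix_cons, Finset.sum_mul, Finset.mul_sum, ← hl]
    rw [Finset.sum_comm]
    conv_rhs => rw [Finset.sum_comm]
    calc _ = ∑ m ∈ states c'.length, s.weight b m *
          ∑ k ∈ states c.length, Word.matrix W m k * charge c k t := by
          simp only [Finset.mul_sum, mul_assoc]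
      _ = ∑ m ∈ states c'.length, s.weight b m *
          ∑ k ∈ states c'.length, charge c' m k * Word.matrix W k t :=
          Finset.sum_congr rfl fun m hm => by rw [ih m hm t ht]
      _ = ∑ k ∈ states c'.length, (∑ m ∈ states c'.length, s.weight b m * charge c' m k) *
            Word.matrix W k t := by
          simp only [Finset.mul_sum, Finset.sum_mul, mul_assoc]
          rw [Finset.sum_comm]
      _ = ∑ k ∈ states c'.length, (∑ m ∈ states a.length, charge a b m * s.weight m k) *
            Word.matrix W k t :=
          Finset.sum_congr rfl fun m hm => by rw [hs b hb m hm]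
      _ = _ := by simp only [Finset.sum_mul, mul_assoc]

/-! ### The elementary pieces commute with both generators -/

theorem forall_states_zero {P : List Bool → Prop} : (∀ b ∈ states 0, P b) ↔ P [] := by
  simp [mem_states]

theorem forall_states_succ {n : ℕ} {P : List Bool → Prop} :
    (∀ b ∈ states (n + 1), P b) ↔ ∀ c, ∀ b ∈ states n, P (c :: b) := by
  constructor
  · intro h c b hb
    exact h _ (mem_states.2 (by simpa [mem_states] using hb))
  · intro h b hb
    rw [mem_states] at hb
    cases b with
    | nil => simp at hb
    | cons c b => exact h c b (mem_states.2 (by simpa using hb))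

theorem Piece.gradeComm_cup (x : Pt) :
    GradeComm (Piece.cup x).src (Piece.cup x).tgt (Piece.cup x).weight := by
  have hq := q_ne_zero
  obtain ⟨a, i, I⟩ := x
  simp only [GradeComm, Piece.src, Piece.tgt, List.length_cons, List.length_nil, zero_add,
    forall_states_succ, forall_states_zero]
  cases a <;> simp [Piece.weight, cupWeight, gradeProd, grade, Pt.flip] <;> field_simp <;> simp

theorem Piece.gradeComm_cap (x : Pt) :
    GradeComm (Piece.cap x).src (Piece.cap x).tgt (Piece.cap x).weight := by
  have hq := q_ne_zero
  obtain ⟨a, i, I⟩ := x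
  simp only [GradeComm, Piece.src, Piece.tgt, List.length_cons, List.length_nil, zero_add,
    forall_states_succ, forall_states_zero]
  cases a <;> simp [Piece.weight, capWeight, gradeProd, grade, Pt.flip] <;> field_simp <;> simp

theorem Piece.gradeComm_twist (p : Bool) (x : Pt) :
    GradeComm (Piece.twist p x).src (Piece.twist p x).tgt (Piece.twist p x).weight := by
  simp only [GradeComm, Piece.src, Piece.tgt, List.length_cons, List.length_nil, zero_add,
    forall_states_succ, forall_states_zero]
  simp [Piece.weight, gradeProd, mul_comm]

theorem Piece.gradeComm_cross (o : Bool) (x y : Pt) :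
    GradeComm (Piece.cross o x y).src (Piece.cross o x y).tgt (Piece.cross o x y).weight := by
  have hq := q_ne_zero
  obtain ⟨a, i, I⟩ := x
  obtain ⟨b, j, J⟩ := y
  simp only [GradeComm, Piece.src, Piece.tgt, List.length_cons, List.length_nil, zero_add,
    forall_states_succ, forall_states_zero, Piece.weight, gradeProd, grade]
  cases a <;> cases b <;> cases o <;> simp [crossWeight] <;> field_simp <;> simp

/-- On the empty list of points E is zero, so the claim is that E kills the minimum. This forces the
ratio of its two weights. -/
theorem Piece.chargeComm_cup (x : Pt) :
    ChargeComm (mark true (Piece.cup x).src) (mark true (Piece.cup x).tgt)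
      (Piece.cup x).weight := by
  have hq := q_ne_zero
  obtain ⟨a, i, I⟩ := x
  simp only [ChargeComm, mark, List.map_cons, List.map_nil, Piece.src, Piece.tgt, List.length_cons,
    List.length_nil, zero_add, forall_states_succ, forall_states_zero, Piece.weight, grade, charge,
    sum_states_succ, sum_states_zero, Pt.flip]
  cases a <;> simp [cupWeight]

theorem Piece.chargeComm_cap (x : Pt) :
    ChargeComm (mark true (Piece.cap x).src) (mark true (Piece.cap x).tgt)
      (Piece.cap x).weight := by
  have hq := q_ne_zero
  obtain ⟨a, i, I⟩ := x
  simp only [ChargeComm, mark, List.map_cons, List.map_nil, Piece.src, Piece.tgt, List.length_cons,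
    List.length_nil, zero_add, forall_states_succ, forall_states_zero, Piece.weight, grade, charge,
    sum_states_succ, sum_states_zero, Pt.flip]
  cases a <;> simp [capWeight]

theorem Piece.chargeComm_twist (p : Bool) (x : Pt) :
    ChargeComm (mark true (Piece.twist p x).src) (mark true (Piece.twist p x).tgt)
      (Piece.twist p x).weight := by
  simp only [ChargeComm, mark, List.map_cons, List.map_nil, Piece.src, Piece.tgt, List.length_cons,
    List.length_nil, zero_add, forall_states_succ, forall_states_zero, Piece.weight, grade, charge,
    sum_states_succ, sum_states_zero]
  cases x.up <;> simp

theorem Piece.chargeComm_cross (o : Bool) (x y : Pt) :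
    ChargeComm (mark true (Piece.cross o x y).src) (mark true (Piece.cross o x y).tgt)
      (Piece.cross o x y).weight := by
  have hq := q_ne_zero
  obtain ⟨a, i, I⟩ := x
  obtain ⟨b, j, J⟩ := y
  simp only [ChargeComm, mark, List.map_cons, List.map_nil, Piece.src, Piece.tgt, List.length_cons,
    List.length_nil, zero_add, forall_states_succ, forall_states_zero, Piece.weight, grade, charge,
    sum_states_succ, sum_states_zero]
  cases a <;> cases b <;> cases o <;> simp [crossWeight, br]
  all_goals and_intros
  -- The goals are identities between sums of powers of `q`: products are merged into single powers,
  -- and the exponents are then normalised. All later verifications of weights follow this pattern.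
  all_goals simp only [mul_sub, sub_mul, div_eq_mul_inv, one_mul, neg_mul, mul_neg, neg_neg,
    neg_sub, mul_one, ← zpow_neg, ← zpow_add₀ hq]
  all_goals ring_nf

theorem Piece.comm_split {x y z : Pt} (h : (Piece.split x y z).Valid) :
    GradeComm (Piece.split x y z).src (Piece.split x y z).tgt (Piece.split x y z).weight ∧
      ChargeComm (mark true (Piece.split x y z).src) (mark true (Piece.split x y z).tgt)
        (Piece.split x y z).weight := by
  have hq := q_ne_zero
  obtain ⟨-, -, -, h, -, h'⟩ := h
  obtain ⟨a, k, K⟩ := x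
  obtain ⟨b, i, I⟩ := y
  obtain ⟨c, j, J⟩ := z
  simp only [GradeComm, ChargeComm, mark, List.map_cons, List.map_nil, Piece.src, Piece.tgt,
    List.length_cons, List.length_nil, zero_add, forall_states_succ, forall_states_zero,
    Piece.weight, gradeProd, grade, charge, sum_states_succ, sum_states_zero]
  simp only [Pt.signBelow, Pt.signAbove] at h h'
  -- The source and the sink contradict `h'`. For the six other orientations `h` gives the stem as
  -- `i + j`, `i - j` or `j - i`.
  cases a <;> cases b <;> cases c <;> simp at h h'
  all_goals
    first
    | have hk : k = i + j := by linarith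
    | have hk : k = i - j := by linarith
    | have hk : k = j - i := by linarith
    subst hk
    simp [splitWeight, vertexWeight, br]
    and_intros
  all_goals simp only [mul_sub, sub_mul, div_eq_mul_inv, one_mul, neg_mul, mul_neg, neg_neg,
      neg_sub, mul_one, ← zpow_neg, ← zpow_add₀ hq]
  all_goals ring_nf

theorem Piece.comm_merge {x y z : Pt} (h : (Piece.merge y z x).Valid) :
    GradeComm (Piece.merge y z x).src (Piece.merge y z x).tgt (Piece.merge y z x).weight ∧
      ChargeComm (mark true (Piece.merge y z x).src) (mark true (Piece.merge y z x).tgt)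
        (Piece.merge y z x).weight := by
  have hq := q_ne_zero
  obtain ⟨-, -, -, h, -, h'⟩ := h
  obtain ⟨a, k, K⟩ := x
  obtain ⟨b, i, I⟩ := y
  obtain ⟨c, j, J⟩ := z
  simp only [GradeComm, ChargeComm, mark, List.map_cons, List.map_nil, Piece.src, Piece.tgt,
    List.length_cons, List.length_nil, zero_add, forall_states_succ, forall_states_zero,
    Piece.weight, gradeProd, grade, charge, sum_states_succ, sum_states_zero]
  simp only [Pt.signBelow, Pt.signAbove] at h h'
  cases a <;> cases b <;> cases c <;> simp at h h'
  all_goals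
    first
    | have hk : k = i + j := by linarith
    | have hk : k = i - j := by linarith
    | have hk : k = j - i := by linarith
    subst hk
    simp [mergeWeight, vertexWeight, br]
    and_intros
  all_goals simp only [mul_sub, sub_mul, div_eq_mul_inv, one_mul, neg_mul, mul_neg, neg_neg,
      neg_sub, mul_one, ← zpow_neg, ← zpow_add₀ hq]
  all_goals ring_nf

theorem Piece.gradeComm {p : Piece} (h : p.Valid) : GradeComm p.src p.tgt p.weight := by
  cases p with
  | cup x => exact gradeComm_cup x
  | cap x => exact gradeComm_cap x
  | twist p x => exact gradeComm_twist p x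
  | cross o x y => exact gradeComm_cross o x y
  | split k i j => exact (comm_split h).1
  | merge i j k => exact (comm_merge h).1

theorem Piece.chargeComm {p : Piece} (h : p.Valid) :
    ChargeComm (mark true p.src) (mark true p.tgt) p.weight := by
  cases p with
  | cup x => exact chargeComm_cup x
  | cap x => exact chargeComm_cap x
  | twist p x => exact chargeComm_twist p x
  | cross o x y => exact chargeComm_cross o x y
  | split k i j => exact (comm_split h).2
  | merge i j k => exact (comm_merge h).2

theorem Piece.chargeComm_mark {p : Piece} (h : p.Valid) (c : Bool) :
    ChargeComm (mark c p.src) (mark c p.tgt) p.weight := by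
  cases c with
  | false =>
    intro b _ t _
    simp [charge_mark_false]
  | true => exact p.chargeComm h

/-! ### Quantum integers -/

/-- A positive power of the indeterminate is not 1, by comparing degrees. This is what makes the
brackets invertible. -/
theorem q_zpow_injective : Function.Injective fun k : ℤ => q ^ k := by
  have key (n : ℕ) (hn : n ≠ 0) : q ^ n ≠ 1 := by
    intro h
    have h' : algebraMap (Polynomial ℚ) (RatFunc ℚ) (Polynomial.X ^ n) =
        algebraMap (Polynomial ℚ) (RatFunc ℚ) 1 := by
      rw [map_pow, RatFunc.algebraMap_X, map_one]
      exact h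
    have h'' := congrArg Polynomial.natDegree (RatFunc.algebraMap_injective ℚ h')
    rw [Polynomial.natDegree_X_pow, Polynomial.natDegree_one] at h''
    exact hn h''
  have key' (k : ℤ) (hk : q ^ k = 1) : k = 0 := by
    by_contra h
    obtain ⟨n, rfl | rfl⟩ := k.eq_nat_or_neg
    · exact key n (by simpa using h) (by simpa using hk)
    · exact key n (by simpa using h) (by simpa using hk)
  intro k l h
  have : q ^ (k - l) = 1 := by
    rw [zpow_sub₀ q_ne_zero]
    exact (div_eq_one_iff_eq (zpow_ne_zero l q_ne_zero)).2 h
  exact sub_eq_zero.1 (key' _ this)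

theorem br_ne_zero {k : ℤ} (h : k ≠ 0) : br k ≠ 0 := by
  intro h'
  have := q_zpow_injective (sub_eq_zero.1 h')
  omega

theorem br_two_mul_ne_zero {k : ℤ} (h : k ≠ 0) : br (2 * k) ≠ 0 := br_ne_zero (by omega)

/-! ### Markings -/

/-- Mark the point at position `p` by `f p`. -/
def markBy : (ℕ → Bool) → List Pt → List (Pt × Bool)
  | _, [] => []
  | f, x :: L => (x, f 0) :: markBy (fun p => f (p + 1)) L

theorem map_fst_markBy (f : ℕ → Bool) (L : List Pt) : (markBy f L).map Prod.fst = L := by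
  induction L generalizing f with
  | nil => rfl
  | cons x L ih => simp [markBy, ih]

theorem length_markBy (f : ℕ → Bool) (L : List Pt) : (markBy f L).length = L.length := by
  rw [← List.length_map (f := Prod.fst), map_fst_markBy]

theorem markBy_append (f : ℕ → Bool) (L₁ L₂ : List Pt) :
    markBy f (L₁ ++ L₂) = markBy f L₁ ++ markBy (fun p => f (L₁.length + p)) L₂ := by
  induction L₁ generalizing f with
  | nil => simp [markBy]
  | cons x L ih => simp [markBy, ih, add_right_comm]

theorem markBy_congr {f g : ℕ → Bool} {L : List Pt} (h : ∀ p < L.length, f p = g p) :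
    markBy f L = markBy g L := by
  induction L generalizing f g with
  | nil => rfl
  | cons x L ih =>
    rw [markBy, markBy, h 0 (by simp), ih fun p hp => h (p + 1) (by simpa using hp)]

theorem markBy_eq_mark {f : ℕ → Bool} {L : List Pt} {c : Bool} (h : ∀ p < L.length, f p = c) :
    markBy f L = mark c L := by
  induction L generalizing f with
  | nil => rfl
  | cons x L ih =>
    rw [markBy, h 0 (by simp), ih fun p hp => h (p + 1) (by simpa using hp)]
    rfl

theorem exists_mem_markBy {f : ℕ → Bool} {L : List Pt} {p : ℕ} (hp : p < L.length)
    (h : f p = true) : ∃ x ∈ markBy f L, x.2 = true := by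
  induction L generalizing f p with
  | nil => simp at hp
  | cons x L ih =>
    cases p with
    | zero => exact ⟨(x, f 0), by simp [markBy], h⟩
    | succ p =>
      obtain ⟨y, hy, hy'⟩ := ih (f := fun p => f (p + 1)) (by simpa using hp) h
      exact ⟨y, List.mem_cons_of_mem _ hy, hy'⟩

/-- The marking `f` of the levels of `W` is constant on the components of all slices. -/
def Compatible (f : ℕ → ℕ → Bool) (W : Word) : Prop :=
  ∀ n s, W[n]? = some s →
    (∀ p < s.left.length, f n p = f (n + 1) p) ∧
    (∀ p < s.right.length, f n (s.left.length + s.piece.src.length + p) =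
      f (n + 1) (s.left.length + s.piece.tgt.length + p)) ∧
    ∃ c, (∀ p < s.piece.src.length, f n (s.left.length + p) = c) ∧
      ∀ p < s.piece.tgt.length, f (n + 1) (s.left.length + p) = c

/-- Compatibility gives one mark to all ends of a piece and lets vertical segments keep theirs, as
`Slice.chargeComm` requires. -/
theorem chargePath_markBy {a c : List Pt} {W : Word} (h : W.IsDiagram a c) {f : ℕ → ℕ → Bool}
    (hf : Compatible f W) : ChargePath (markBy (f 0) a) W (markBy (f W.length) c) := by
  induction W generalizing a f with
  | nil =>
    obtain rfl : a = c := h.1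
    rfl
  | cons s W ih =>
    obtain ⟨⟨rfl, h⟩, hv⟩ := h
    have hs := hv s List.mem_cons_self
    refine ⟨map_fst_markBy _ _, markBy (f 1) s.tgt, map_fst_markBy _ _, ?_,
      ih (f := fun n => f (n + 1)) ⟨h, fun s hs => hv s (List.mem_cons_of_mem _ hs)⟩
        fun n t ht => hf (n + 1) t ht⟩
    obtain ⟨hl, hr, k, hk, hk'⟩ := hf 0 s rfl
    have key := s.chargeComm (p := k) (p' := k) (map_fst_markBy (f 0) s.left)
      (map_fst_markBy (fun p => f 0 (s.left.length + s.piece.src.length + p)) s.right)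
      (s.piece.gradeComm hs) (s.piece.chargeComm_mark hs k)
    rw [Slice.src, Slice.tgt, markBy_append, markBy_append, markBy_append, markBy_append,
      markBy_eq_mark hk, markBy_eq_mark hk', ← markBy_congr hl]
    simp only [List.length_append]
    rw [← markBy_congr hr]
    exact key

/-! ### The matrix of a cut diagram -/

theorem charge_singleton (x : Pt) (c b t : Bool) :
    charge [(x, c)] [b] [t] = if c = true ∧ b = x.up ∧ t = !b then 1 else 0 := by
  simp [charge]

theorem IsCutDiagram.gradeComm {x : Pt} {W : Word} (h : IsCutDiagram x W) :
    GradeComm [x] [x] W.matrix :=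
  GradeComm.matrix h.2.1 fun s hs => s.gradeComm (s.piece.gradeComm (h.2.2 s hs))

theorem IsCutDiagram.chargeComm {x : Pt} {W : Word} (h : IsCutDiagram x W) :
    ChargeComm [(x, true)] [(x, true)] W.matrix :=
  (chargePath_markBy (f := fun _ _ => true) h.2
    fun _ _ _ => ⟨by simp, by simp, true, by simp, by simp⟩).chargeComm

/-- Commuting with K multiplies an off-diagonal entry by -1. -/
theorem IsCutDiagram.matrix_of_ne {x : Pt} {W : Word} (h : IsCutDiagram x W) (s : Bool) :
    W.matrix [s] [!s] = 0 := by
  have := h.gradeComm [s] (mem_states.2 rfl) [!s] (mem_states.2 rfl)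
  simp only [gradeProd, mul_one, grade_not] at this
  have h' : (2 * grade x s) * W.matrix [s] [!s] = 0 := by linear_combination this
  exact (mul_eq_zero.1 h').resolve_left (mul_ne_zero two_ne_zero (grade_ne_zero x s))

theorem IsCutDiagram.matrix_diag {x : Pt} {W : Word} (h : IsCutDiagram x W) (s : Bool) :
    W.matrix [s] [s] = W.matrix [false] [false] := by
  -- The only nonzero entry of E on one strand is the one from `x.up` to `!x.up`; there the relation
  -- compares the two diagonal entries.
  have := h.chargeComm [x.up] (mem_states.2 rfl) [!x.up] (mem_states.2 rfl)
  simp only [List.length_singleton, sum_states_one, charge_singleton] at this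
  cases hx : x.up <;> cases s <;> simp_all

theorem IsCutDiagram.matrix_eq {x : Pt} {W : Word} (h : IsCutDiagram x W) (s t : Bool) :
    W.matrix [s] [t] = if s = t then br (2 * x.mult) * alexander x W else 0 := by
  by_cases hst : s = t
  · subst hst
    rw [if_pos rfl, alexander, mul_div_cancel₀ _ (br_two_mul_ne_zero h.1), h.matrix_diag]
  · obtain rfl : t = !s := by cases s <;> cases t <;> simp_all
    rw [if_neg hst, h.matrix_of_ne]

/-! ### Disconnected diagrams -/

theorem Word.exists_path_of_append {a c : List Pt} {W₁ W₂ : Word}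
    (h : Word.Path a (W₁ ++ W₂) c) : ∃ d, W₁.Path a d ∧ W₂.Path d c := by
  induction W₁ generalizing a with
  | nil => exact ⟨a, rfl, h⟩
  | cons s W ih =>
    obtain ⟨d, h₁, h₂⟩ := ih h.2
    exact ⟨d, ⟨h.1, h₁⟩, h₂⟩

/-- A diagram vanishes if it has a marked component at some level, but not at its ends. -/
theorem sum_eq_zero_of_chargeComm {a c : List Pt} {d : List (Pt × Bool)}
    {A B : List Bool → List Bool → RatFunc ℚ}
    (hA : ChargeComm (mark false a) d A) (hB : ChargeComm d (mark false c) B)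
    (hd : ∃ x ∈ d, x.2 = true) {b t : List Bool} (hb : b.length = a.length)
    (ht : t.length = c.length) :
    ∑ m ∈ states d.length, A b m * B m t = 0 := by
  obtain ⟨Y, hY⟩ := exists_homotopy d hd
  have hA' (m) (hm : m ∈ states d.length) : ∑ k ∈ states d.length, A b k * charge d k m = 0 := by
    rw [hA b (mem_states.2 (by rwa [length_mark])) m hm]
    simp [charge_mark_false]
  have hB' (m) (hm : m ∈ states d.length) : ∑ k ∈ states d.length, charge d m k * B k t = 0 := by
    rw [← hB m hm t (mem_states.2 (by rwa [length_mark]))]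
    simp [charge_mark_false]
  -- The identity between `A` and `B` is replaced by EY + YE, and the sums are reordered so that AE
  -- and EB appear as inner sums.
  calc ∑ m ∈ states d.length, A b m * B m t
      = ∑ m ∈ states d.length, ∑ k ∈ states d.length,
          A b m * (if m = k then 1 else 0) * B k t := by
        refine Finset.sum_congr rfl fun m hm => ?_
        simp [hm]
    _ = ∑ m ∈ states d.length, ∑ k ∈ states d.length, ∑ r ∈ states d.length,
          (A b m * charge d m r * (Y r k * B k t) +
            A b m * Y m r * (charge d r k * B k t)) := by
        refine Finset.sum_congr rfl fun m hm => Finset.sum_congr rfl fun k hk => ?_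
        rw [← hY m hm k hk, Finset.mul_sum, Finset.sum_mul]
        exact Finset.sum_congr rfl fun r _ => by ring
    _ = (∑ r ∈ states d.length, ∑ k ∈ states d.length,
          (∑ m ∈ states d.length, A b m * charge d m r) * (Y r k * B k t)) +
        ∑ m ∈ states d.length, ∑ r ∈ states d.length,
          A b m * Y m r * ∑ k ∈ states d.length, charge d r k * B k t := by
        simp only [Finset.sum_add_distrib, Finset.sum_mul, Finset.mul_sum]
        congr 1
        · exact (Finset.sum_congr rfl fun m _ => Finset.sum_comm).trans
            (Finset.sum_comm.trans (Finset.sum_congr rfl fun r _ => Finset.sum_comm))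
        · exact Finset.sum_congr rfl fun m _ => Finset.sum_comm
    _ = 0 := by
        rw [Finset.sum_eq_zero fun r hr => Finset.sum_eq_zero fun k _ => by
            rw [hA' r hr, zero_mul],
          Finset.sum_eq_zero fun m _ => Finset.sum_eq_zero fun r hr => by
            rw [hB' r hr, mul_zero], add_zero]

theorem alexander_eq_zero_of_marking {x : Pt} {W : Word} (h : IsCutDiagram x W)
    {f : ℕ → ℕ → Bool} (hf : Compatible f W) (h₀ : f 0 0 = false) (h₁ : f W.length 0 = false)
    {n p : ℕ} (hp : f n p = true) (hn : W.IsPoint (n, p)) : alexander x W = 0 := by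
  obtain ⟨-, hW, hv⟩ := h
  obtain ⟨W₁, W₂, d, rfl, rfl, hd, hd'⟩ : ∃ W₁ W₂ d, W = W₁ ++ W₂ ∧ W₁.length = n ∧
      (W₁.Path [x] d ∧ W₂.Path d [x]) ∧ p < d.length := by
    -- The word is cut below slice `n` or above slice `m = n - 1`. The second form is needed for the
    -- topmost level, which has no slice above it.
    rcases hn with ⟨s, hs, hp⟩ | ⟨m, s, hm, hs, hp⟩
    · obtain ⟨hn, rfl⟩ := List.getElem?_eq_some_iff.1 hs
      have e : W = W.take n ++ (W[n] :: W.drop (n + 1)) := by simp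
      have hW' := hW
      rw [e] at hW'
      obtain ⟨d, hd₁, hd₂⟩ := Word.exists_path_of_append hW'
      exact ⟨_, _, d, e, by simpa using hn.le, ⟨hd₁, hd₂⟩, by rw [hd₂.1]; exact hp⟩
    · obtain rfl : n = m + 1 := hm
      obtain ⟨hn, rfl⟩ := List.getElem?_eq_some_iff.1 hs
      have e : W = W.take m ++ (W[m] :: W.drop (m + 1)) := by simp
      have hW' := hW
      rw [e] at hW'
      obtain ⟨d, hd₁, hd₂⟩ := Word.exists_path_of_append hW'
      exact ⟨W.take m ++ [W[m]], W.drop (m + 1), W[m].tgt, by simp, by simp; omega,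
        ⟨Word.path_append hd₁ ⟨hd₂.1, rfl⟩, hd₂.2⟩, hp⟩
  have hf₁ : Compatible f W₁ := fun n s hs => hf n s (by
    rw [List.getElem?_append_left (List.getElem?_eq_some_iff.1 hs).1, hs])
  have hf₂ : Compatible (fun n => f (W₁.length + n)) W₂ := fun n s hs =>
    hf (W₁.length + n) s (by rw [List.getElem?_append_right (by omega)]; simpa using hs)
  have c₁ := (chargePath_markBy ⟨hd.1, fun s hs => hv s (List.mem_append_left _ hs)⟩ hf₁).chargeComm
  have c₂ := (chargePath_markBy ⟨hd.2, fun s hs => hv s (List.mem_append_right _ hs)⟩ hf₂).chargeComm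
  rw [markBy_eq_mark (c := false) (by simpa using h₀)] at c₁
  rw [List.length_append] at h₁
  rw [markBy_eq_mark (c := false) (L := [x]) (by simpa using h₁)] at c₂
  have key := sum_eq_zero_of_chargeComm c₁ c₂ (exists_mem_markBy hd' hp) (b := [false])
    (t := [false]) rfl rfl
  rw [length_markBy] at key
  rw [alexander, Word.matrix_append hd.1 _ rfl, key, zero_div]

theorem alexander_eq_zero_of_disconnected {x : Pt} {W : Word} (h : IsCutDiagram x W)
    (hW : W.Disconnected) : alexander x W = 0 := by
  classical
  -- Of two points that are not connected, at least one is not connected to the cut. Its component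
  -- is the one to be marked.
  obtain ⟨u, hu, hu₀⟩ : ∃ u, W.IsPoint u ∧ ¬ Relation.EqvGen W.Joined u (0, 0) := by
    obtain ⟨u, v, hu, hv, huv⟩ := hW
    by_cases h₀ : Relation.EqvGen W.Joined u (0, 0)
    · exact ⟨v, hv, fun hv₀ => huv (h₀.trans _ _ _ (hv₀.symm _ _))⟩
    · exact ⟨u, hu, h₀⟩
  have key {v w : ℕ × ℕ} (hvw : W.Joined v w) :
      decide (Relation.EqvGen W.Joined u v) = decide (Relation.EqvGen W.Joined u w) :=
    decide_eq_decide.2 ⟨fun h => h.trans _ _ _ (.rel _ _ hvw),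
      fun h => h.trans _ _ _ ((Relation.EqvGen.rel _ _ hvw).symm)⟩
  refine alexander_eq_zero_of_marking h
    (f := fun n p => decide (Relation.EqvGen W.Joined u (n, p))) (n := u.1) (p := u.2)
    (fun n s hs => ⟨fun p hp => key (.left hs hp), fun p hp => key (.right hs hp), ?_⟩)
    -- The two ends of the cut edge are joined, so the top end is unmarked as well.
    (decide_eq_false hu₀) ((key .cut).symm.trans (decide_eq_false hu₀))
    (decide_eq_true (.refl u)) hu
  -- The common mark of a piece is read off at its first bottom end, or at its first top end if it
  -- has none below.
  by_cases h₀ : s.piece.src.length = 0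
  · by_cases h₁ : s.piece.tgt.length = 0
    · exact ⟨true, by simp [h₀], by simp [h₁]⟩
    · exact ⟨_, by simp [h₀], fun p hp => key (.top hs hp (Nat.pos_of_ne_zero h₁))⟩
  · exact ⟨_, fun p hp => key (.bottom hs hp (Nat.pos_of_ne_zero h₀)),
      fun p hp => (key (.through hs (Nat.pos_of_ne_zero h₀) hp)).symm⟩

/-! ### Local relations -/

/-- The linear functional of the matrix of a local diagram given by the diagram outside. -/
noncomputable def Context.eval {a b : List Pt} (C : Context a b)
    (M : List Bool → List Bool → RatFunc ℚ) : RatFunc ℚ :=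
  ∑ u ∈ states C.left.length, ∑ v ∈ states a.length, ∑ w ∈ states C.right.length,
    ∑ v' ∈ states b.length, C.below.matrix [false] (u ++ v ++ w) * M v v' *
      C.above.matrix (u ++ v' ++ w) [false] / br (2 * C.base.mult)

/-- The strands beside the disk pass unchanged, so the same outer states `u` and `w` occur below and
above it. -/
theorem Context.value_eq_eval {a b : List Pt} (C : Context a b) {D : Scaled}
    (h : D.word.Path a b) : C.value D = C.eval fun s t => D.coeff * D.word.matrix s t := by
  have hw := Word.path_whisker h C.left C.right
  rw [Context.value, alexander, List.append_assoc,
    Word.matrix_append C.below_diagram.1 _ rfl, Context.eval]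
  rw [List.length_append, List.length_append, sum_states_add, sum_states_add, Finset.sum_div,
    Finset.mul_sum]
  refine Finset.sum_congr rfl fun u hu => ?_
  rw [Finset.sum_div, Finset.mul_sum]
  refine Finset.sum_congr rfl fun v hv => ?_
  rw [Finset.sum_div, Finset.mul_sum]
  refine Finset.sum_congr rfl fun w hww => ?_
  rw [mem_states] at hu hv hww
  have e : Word.matrix (D.word.whisker C.left C.right ++ C.above) (u ++ v ++ w) [false] =
      ∑ v' ∈ states b.length, D.word.matrix v v' * C.above.matrix (u ++ v' ++ w) [false] := by
    rw [Word.matrix_append hw _ (by simp [*]), List.length_append, List.length_append,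
      sum_states_add, sum_states_add, ← sum_states_eq hu fun u => ∑ v' ∈ states b.length,
        D.word.matrix v v' * C.above.matrix (u ++ v' ++ w) [false]]
    refine Finset.sum_congr rfl fun u' hu' => ?_
    rw [ite_sum_zero]
    refine Finset.sum_congr rfl fun v' hv' => ?_
    rw [← sum_states_eq hww fun w =>
      D.word.matrix v v' * C.above.matrix (u' ++ v' ++ w) [false], ite_sum_zero]
    refine Finset.sum_congr rfl fun w' _ => ?_
    rw [Word.matrix_whisker h _ _ hu (mem_states.1 hu') hv (mem_states.1 hv') hww]
    by_cases h₁ : u = u' <;> by_cases h₂ : w = w' <;> simp [h₁, h₂]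
  rw [e, Finset.mul_sum, Finset.sum_div, Finset.mul_sum]
  exact Finset.sum_congr rfl fun _ _ => by ring

theorem Context.eval_congr {a b : List Pt} (C : Context a b)
    {M N : List Bool → List Bool → RatFunc ℚ}
    (h : ∀ s ∈ states a.length, ∀ t ∈ states b.length, M s t = N s t) : C.eval M = C.eval N :=
  Finset.sum_congr rfl fun _ _ => Finset.sum_congr rfl fun v hv => Finset.sum_congr rfl fun _ _ =>
    Finset.sum_congr rfl fun v' hv' => by rw [h v hv v' hv']

theorem Context.eval_smul_add {a b : List Pt} (C : Context a b) (k l : RatFunc ℚ)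
    (M N : List Bool → List Bool → RatFunc ℚ) :
    (C.eval fun s t => k * M s t + l * N s t) = k * C.eval M + l * C.eval N := by
  simp only [Context.eval, Finset.mul_sum, ← Finset.sum_add_distrib]
  exact Finset.sum_congr rfl fun _ _ => Finset.sum_congr rfl fun _ _ =>
    Finset.sum_congr rfl fun _ _ => Finset.sum_congr rfl fun _ _ => by ring

/-- A linear relation between the local matrices implies one between the polynomials. -/
theorem Context.value_eq_add {a b : List Pt} (C : Context a b) {D D₁ D₂ : Scaled}
    {k₁ k₂ : RatFunc ℚ} (h : D.word.Path a b) (h₁ : D₁.word.Path a b) (h₂ : D₂.word.Path a b)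
    (H : ∀ s ∈ states a.length, ∀ t ∈ states b.length, D.coeff * D.word.matrix s t =
      k₁ * (D₁.coeff * D₁.word.matrix s t) + k₂ * (D₂.coeff * D₂.word.matrix s t)) :
    C.value D = k₁ * C.value D₁ + k₂ * C.value D₂ := by
  rw [C.value_eq_eval h, C.value_eq_eval h₁, C.value_eq_eval h₂, ← C.eval_smul_add]
  exact C.eval_congr H

theorem Context.value_eq_mul {a b : List Pt} (C : Context a b) {D D₁ : Scaled}
    {k : RatFunc ℚ} (h : D.word.Path a b) (h₁ : D₁.word.Path a b)
    (H : ∀ s ∈ states a.length, ∀ t ∈ states b.length, D.coeff * D.word.matrix s t =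
      k * (D₁.coeff * D₁.word.matrix s t)) :
    C.value D = k * C.value D₁ := by
  have := C.value_eq_add (k₁ := k) (k₂ := 0) h h₁ h₁ fun s hs t ht => by rw [H s hs t ht]; ring
  rw [this]
  ring

/-! ### Evaluation of local diagrams -/

section

variable (W : Word) (l : List Pt) (r : List Pt) (x y z : Pt) (t : List Bool)

theorem matrix_split {L R : List Bool} (hL : L.length = l.length) (hR : R.length = r.length)
    (s : Bool) :
    Word.matrix (⟨l, .split x y z, r⟩ :: W) (L ++ s :: R) t =
      splitWeight x y z s false false * Word.matrix W (L ++ false :: false :: R) t +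
      splitWeight x y z s false true * Word.matrix W (L ++ false :: true :: R) t +
      (splitWeight x y z s true false * Word.matrix W (L ++ true :: false :: R) t +
      splitWeight x y z s true true * Word.matrix W (L ++ true :: true :: R) t) := by
  have := Word.matrix_cons_append ⟨l, .split x y z, r⟩ W (b₁ := L) (b₂ := [s]) (b₃ := R) t hL rfl hR
  simpa [Piece.tgt, Piece.weight, sum_states_two] using this

theorem matrix_merge {L R : List Bool} (hL : L.length = l.length) (hR : R.length = r.length)
    (s s' : Bool) :
    Word.matrix (⟨l, .merge x y z, r⟩ :: W) (L ++ s :: s' :: R) t =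
      mergeWeight x y z false s s' * Word.matrix W (L ++ false :: R) t +
      mergeWeight x y z true s s' * Word.matrix W (L ++ true :: R) t := by
  have := Word.matrix_cons_append ⟨l, .merge x y z, r⟩ W (b₁ := L) (b₂ := [s, s']) (b₃ := R) t
    hL rfl hR
  simpa [Piece.tgt, Piece.weight, sum_states_one] using this

end

theorem Word.matrix_nil (b t : List Bool) : Word.matrix [] b t = if b = t then 1 else 0 := rfl

/-- The cases of zero and one strand on the left are stated separately, so that explicit lists of
states match them as rewrite rules. -/
theorem matrix_split_nil (W : Word) (r : List Pt) (x y z : Pt) (s : Bool) (R t : List Bool)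
    (hR : R.length = r.length) :
    Word.matrix (⟨[], .split x y z, r⟩ :: W) (s :: R) t =
      splitWeight x y z s false false * Word.matrix W (false :: false :: R) t +
      splitWeight x y z s false true * Word.matrix W (false :: true :: R) t +
      (splitWeight x y z s true false * Word.matrix W (true :: false :: R) t +
      splitWeight x y z s true true * Word.matrix W (true :: true :: R) t) :=
  matrix_split W [] r x y z t (L := []) rfl hR s

theorem matrix_split_singleton (W : Word) (r : List Pt) (w x y z : Pt) (s' s : Bool)
    (R t : List Bool) (hR : R.length = r.length) :
    Word.matrix (⟨[w], .split x y z, r⟩ :: W) (s' :: s :: R) t =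
      splitWeight x y z s false false * Word.matrix W (s' :: false :: false :: R) t +
      splitWeight x y z s false true * Word.matrix W (s' :: false :: true :: R) t +
      (splitWeight x y z s true false * Word.matrix W (s' :: true :: false :: R) t +
      splitWeight x y z s true true * Word.matrix W (s' :: true :: true :: R) t) :=
  matrix_split W [w] r x y z t (L := [s']) rfl hR s

theorem matrix_merge_nil (W : Word) (r : List Pt) (x y z : Pt) (s s' : Bool) (R t : List Bool)
    (hR : R.length = r.length) :
    Word.matrix (⟨[], .merge x y z, r⟩ :: W) (s :: s' :: R) t =
      mergeWeight x y z false s s' * Word.matrix W (false :: R) t +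
      mergeWeight x y z true s s' * Word.matrix W (true :: R) t :=
  matrix_merge W [] r x y z t (L := []) rfl hR s s'

theorem matrix_merge_singleton (W : Word) (r : List Pt) (w x y z : Pt) (c s s' : Bool)
    (R t : List Bool) (hR : R.length = r.length) :
    Word.matrix (⟨[w], .merge x y z, r⟩ :: W) (c :: s :: s' :: R) t =
      mergeWeight x y z false s s' * Word.matrix W (c :: false :: R) t +
      mergeWeight x y z true s s' * Word.matrix W (c :: true :: R) t :=
  matrix_merge W [w] r x y z t (L := [c]) rfl hR s s'

theorem matrix_cup_nil (W : Word) (r : List Pt) (x : Pt) (R t : List Bool)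
    (hR : R.length = r.length) :
    Word.matrix (⟨[], .cup x, r⟩ :: W) R t =
      cupWeight x false * Word.matrix W (false :: false :: R) t +
      cupWeight x true * Word.matrix W (true :: true :: R) t := by
  have := Word.matrix_cons_append ⟨[], .cup x, r⟩ W (b₁ := []) (b₂ := []) (b₃ := R) t rfl rfl hR
  simpa [Piece.tgt, Piece.weight, sum_states_two] using this

theorem matrix_cup_singleton (W : Word) (r : List Pt) (w x : Pt) (c : Bool) (R t : List Bool)
    (hR : R.length = r.length) :
    Word.matrix (⟨[w], .cup x, r⟩ :: W) (c :: R) t =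
      cupWeight x false * Word.matrix W (c :: false :: false :: R) t +
      cupWeight x true * Word.matrix W (c :: true :: true :: R) t := by
  have := Word.matrix_cons_append ⟨[w], .cup x, r⟩ W (b₁ := [c]) (b₂ := []) (b₃ := R) t rfl rfl hR
  simpa [Piece.tgt, Piece.weight, sum_states_two] using this

theorem matrix_cap_nil (W : Word) (r : List Pt) (x : Pt) (s s' : Bool) (R t : List Bool)
    (hR : R.length = r.length) :
    Word.matrix (⟨[], .cap x, r⟩ :: W) (s :: s' :: R) t =
      if s = s' then capWeight x s * Word.matrix W R t else 0 := by
  have := Word.matrix_cons_append ⟨[], .cap x, r⟩ W (b₁ := []) (b₂ := [s, s']) (b₃ := R) t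
    rfl rfl hR
  simpa [Piece.tgt, Piece.weight, sum_states_zero] using this

theorem matrix_cap_singleton (W : Word) (r : List Pt) (w x : Pt) (c s s' : Bool) (R t : List Bool)
    (hR : R.length = r.length) :
    Word.matrix (⟨[w], .cap x, r⟩ :: W) (c :: s :: s' :: R) t =
      if s = s' then capWeight x s * Word.matrix W (c :: R) t else 0 := by
  have := Word.matrix_cons_append ⟨[w], .cap x, r⟩ W (b₁ := [c]) (b₂ := [s, s']) (b₃ := R) t
    rfl rfl hR
  simpa [Piece.tgt, Piece.weight, sum_states_zero] using this

theorem matrix_twist (p : Bool) (x : Pt) (s t : Bool) :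
    Word.matrix [⟨[], .twist p x, []⟩] [s] [t] = if s = t then twistWeight p x else 0 := by
  have := Word.matrix_cons_append ⟨[], .twist p x, []⟩ [] (b₁ := []) (b₂ := [s]) (b₃ := []) [t]
    rfl rfl rfl
  rw [List.nil_append, List.append_nil] at this
  rw [this]
  cases s <;> cases t <;> simp [Piece.tgt, Piece.weight, sum_states_one, Word.matrix_nil, mem_states]

theorem matrix_cross (o : Bool) (x y : Pt) (s s' t t' : Bool) :
    Word.matrix [⟨[], .cross o x y, []⟩] [s, s'] [t, t'] = crossWeight o x y s s' t t' := by
  have := Word.matrix_cons_append ⟨[], .cross o x y, []⟩ [] (b₁ := []) (b₂ := [s, s']) (b₃ := [])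
    [t, t'] rfl rfl rfl
  rw [List.nil_append, List.append_nil] at this
  rw [this]
  cases t <;> cases t' <;> simp [Piece.tgt, Piece.weight, sum_states_two, Word.matrix_nil, mem_states]

/-! ### Circle, half twist and bigon -/

theorem alexander_strand {x : Pt} : alexander x [] = 1 / br (2 * x.mult) := by
  simp [alexander, Word.matrix_nil]

/-- The opened circle is a strand bent into two zigzags. In state `e₀` the minimum and the maximum
of each zigzag have inverse weights. -/
theorem alexander_circle (x : Pt) :
    alexander x.flip (cutLeft [⟨[], .cup x, []⟩] x [x.flip] [⟨[], .cap x, []⟩]) =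
      1 / br (2 * x.mult) := by
  have hq := q_ne_zero
  obtain ⟨a, i, I⟩ := x
  simp only [alexander, cutLeft, Word.whisker, List.map_cons, List.map_nil, List.append_nil,
    List.cons_append, List.nil_append]
  congr 1
  rw [matrix_cup_singleton _ _ _ _ _ _ _ rfl, matrix_cap_nil _ _ _ _ _ _ _ rfl,
    matrix_cap_nil _ _ _ _ _ _ _ rfl, matrix_cup_nil _ _ _ _ _ rfl,
    matrix_cap_singleton _ _ _ _ _ _ _ _ _ rfl, matrix_cap_singleton _ _ _ _ _ _ _ _ _ rfl]
  cases a <;> simp [Word.matrix_nil, cupWeight, capWeight, Pt.flip] <;> field_simp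

theorem value_twisted (x : Pt) (C : Context [x] [x]) :
    C.value (twisted true x) = q ^ (-(x.mult * x.wt)) * C.value strands ∧
      C.value (twisted false x) = q ^ (x.mult * x.wt) * C.value strands := by
  constructor
  all_goals
    refine C.value_eq_mul ⟨rfl, rfl⟩ rfl ?_
    simp only [List.length_cons, List.length_nil, zero_add, forall_states_succ, forall_states_zero]
    simp [twisted, strands, matrix_twist, twistWeight, Word.matrix_nil]

theorem value_bigon (x y z : Pt) (C : Context [x] [x]) (h : C.Admits (bigon x y z)) :
    C.value (bigon x y z) = br (2 * x.mult) * C.value strands := by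
  have hq := q_ne_zero
  refine C.value_eq_mul h.1 rfl ?_
  by_cases h₀ : (y.mult = 0 ∧ z = x) ∨ (z.mult = 0 ∧ y = x)
  · intro s _ t _
    simp [bigon, h₀, strands]
  · have hv := h.2 ⟨[], .split x y z, []⟩ (by simp [bigon, h₀])
    obtain ⟨-, -, -, h₁, -, h₂⟩ := hv
    obtain ⟨a, k, K⟩ := x
    obtain ⟨b, i, I⟩ := y
    obtain ⟨c, j, J⟩ := z
    simp only [List.length_cons, List.length_nil, zero_add, forall_states_succ, forall_states_zero]
    simp only [bigon, h₀, if_false, strands, matrix_split_nil, matrix_merge_nil, List.length_nil,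
      Word.matrix_nil, one_mul]
    simp only [Pt.signBelow, Pt.signAbove] at h₁ h₂
    cases a <;> cases b <;> cases c <;> simp at h₁ h₂
    all_goals
      first
      | have hk : k = i + j := by linarith
      | have hk : k = i - j := by linarith
      | have hk : k = j - i := by linarith
      subst hk
      simp [splitWeight, mergeWeight, vertexWeight, br]
    all_goals simp only [mul_sub, sub_mul, div_eq_mul_inv, one_mul, neg_mul, mul_neg, neg_neg,
      neg_sub, mul_one, ← zpow_neg, ← zpow_add₀ hq]
    all_goals ring_nf

/-- With the denominator cleared, the local identity involves only Laurent polynomials. -/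
theorem Context.value_eq_add_div {a b : List Pt} (C : Context a b) {D D₁ D₂ : Scaled}
    {k k₁ k₂ : RatFunc ℚ} (hk : k ≠ 0) (h : D.word.Path a b) (h₁ : D₁.word.Path a b)
    (h₂ : D₂.word.Path a b)
    (H : ∀ s ∈ states a.length, ∀ t ∈ states b.length, k * (D.coeff * D.word.matrix s t) =
      k₁ * (D₁.coeff * D₁.word.matrix s t) + k₂ * (D₂.coeff * D₂.word.matrix s t)) :
    C.value D = k₁ / k * C.value D₁ + k₂ / k * C.value D₂ := by
  refine C.value_eq_add h h₁ h₂ fun s hs t ht => ?_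
  rw [div_mul_eq_mul_div, div_mul_eq_mul_div, ← add_div, eq_div_iff hk, ← H s hs t ht, mul_comm]

/-! ### Relations between planar diagrams with vertices -/

theorem br_zero : br 0 = 0 := by simp [br]

theorem value_antiSquare (i j I J S T U V E : ℤ) (C : Context [up j J, dn i I] [up j J, dn i I])
    (h₁ : C.Admits
      (antiSquare (up j J) (dn i I) (up (i + j) S) (up (i + j) T) (dn i U) (up j V)))
    (h₂ : C.Admits (antiDouble (up j J) (dn i I) (dn (i - j) E))) :
    C.value (antiSquare (up j J) (dn i I) (up (i + j) S) (up (i + j) T) (dn i U) (up j V)) =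
      br (2 * i + 2 * j) * C.value (antiDouble (up j J) (dn i I) (dn (i - j) E)) +
        br (2 * j) ^ 2 * C.value strands := by
  have hq := q_ne_zero
  refine C.value_eq_add h₁.1 h₂.1 rfl ?_
  simp only [List.length_cons, List.length_nil, zero_add, forall_states_succ, forall_states_zero]
  -- For equal multiplicities the connecting edge is removed, and the two vertices become a maximum
  -- and a minimum above it.
  by_cases h₀ : i - j = 0
  · obtain rfl : i = j := by linarith
    simp only [antiSquare, antiDouble, strands, up, dn, matrix_split_nil, matrix_split_singleton,
      matrix_merge_nil, matrix_merge_singleton, matrix_cap_nil, matrix_cup_nil, List.length_cons,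
      List.length_nil, Word.matrix_nil, h₀, if_true]
    simp [splitWeight, mergeWeight, vertexWeight, cupWeight, capWeight, br, pow_two]
    and_intros
    all_goals simp only [mul_sub, sub_mul, div_eq_mul_inv, one_mul, neg_mul, mul_neg, neg_neg,
      neg_sub, mul_one, ← zpow_neg, ← zpow_add₀ hq]
    all_goals ring_nf
  · simp only [antiSquare, antiDouble, strands, up, dn, matrix_split_nil, matrix_split_singleton,
      matrix_merge_nil, matrix_merge_singleton, List.length_cons,
      List.length_nil, Word.matrix_nil, h₀, if_false]
    simp [splitWeight, mergeWeight, vertexWeight, br, pow_two]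
    and_intros
    all_goals simp only [mul_sub, sub_mul, div_eq_mul_inv, one_mul, neg_mul, mul_neg, neg_neg,
      neg_sub, mul_one, ← zpow_neg, ← zpow_add₀ hq]
    all_goals ring_nf

theorem value_splitLeft (i j k I J K R R' T : ℤ)
    (C : Context [up (i + j + k) T] [up i I, up j J, up k K])
    (h₁ : C.Admits (splitLeft (up (i + j + k) T) (up (i + j) R) (up i I) (up j J) (up k K)))
    (h₂ : C.Admits (splitRight (up (i + j + k) T) (up (j + k) R') (up i I) (up j J) (up k K))) :
    C.value (splitLeft (up (i + j + k) T) (up (i + j) R) (up i I) (up j J) (up k K)) =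
      br (2 * i + 2 * j) / br (2 * j + 2 * k) *
        C.value (splitRight (up (i + j + k) T) (up (j + k) R') (up i I) (up j J) (up k K)) := by
  have hq := q_ne_zero
  -- The denominator is nonzero because `j + k` is the multiplicity of the inner edge of the second
  -- diagram.
  have hv : j + k ≠ 0 := (h₂.2 _ (List.mem_cons_of_mem _ List.mem_cons_self)).1
  have hk : br (2 * j + 2 * k) ≠ 0 := br_ne_zero (by omega)
  refine C.value_eq_mul h₁.1 h₂.1 fun s hs t ht => ?_
  rw [div_mul_eq_mul_div, eq_div_iff hk]
  revert s t
  simp only [List.length_cons, List.length_nil, zero_add, forall_states_succ, forall_states_zero]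
  simp only [splitLeft, splitRight, up, matrix_split_nil, matrix_split_singleton, List.length_cons,
    List.length_nil, Word.matrix_nil]
  clear hk
  simp [splitWeight, vertexWeight, br]
  and_intros
  all_goals simp only [mul_sub, sub_mul, div_eq_mul_inv, one_mul, neg_mul, mul_neg, neg_neg,
    neg_sub, mul_one, ← zpow_neg, ← zpow_add₀ hq]
  all_goals ring_nf

theorem value_mergeLeft (i j k I J K R R' T : ℤ)
    (C : Context [up i I, up j J, up k K] [up (i + j + k) T])
    (h₁ : C.Admits (mergeLeft (up (i + j + k) T) (up (i + j) R) (up i I) (up j J) (up k K)))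
    (h₂ : C.Admits (mergeRight (up (i + j + k) T) (up (j + k) R') (up i I) (up j J) (up k K))) :
    C.value (mergeLeft (up (i + j + k) T) (up (i + j) R) (up i I) (up j J) (up k K)) =
      C.value (mergeRight (up (i + j + k) T) (up (j + k) R') (up i I) (up j J) (up k K)) := by
  have hq := q_ne_zero
  rw [← one_mul (C.value (mergeRight _ _ _ _ _))]
  refine C.value_eq_mul h₁.1 h₂.1 ?_
  simp only [List.length_cons, List.length_nil, zero_add, forall_states_succ, forall_states_zero]
  simp only [mergeLeft, mergeRight, up, matrix_merge_nil, matrix_merge_singleton, List.length_cons,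
    List.length_nil, Word.matrix_nil]
  simp [mergeWeight, vertexWeight]
  simp only [← zpow_add₀ hq]
  ring_nf

/-- The merge-and-split diagram is the source of the nonzero denominators in the ladder and crossing
relations. -/
theorem mult_ne_zero_of_double {x y s x' y' : Pt} {a b : List Pt}
    (h : (double x y s x' y').word.IsDiagram a b) :
    x.mult ≠ 0 ∧ y.mult ≠ 0 ∧ s.mult ≠ 0 ∧ x'.mult ≠ 0 ∧ y'.mult ≠ 0 := by
  have h₁ := h.2 _ List.mem_cons_self
  have h₂ := h.2 _ (List.mem_cons_of_mem _ List.mem_cons_self)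
  exact ⟨h₁.1, h₁.2.1, h₂.1, h₂.2.1, h₂.2.2.1⟩

theorem value_square (i j k l I J I' J' K L M N S E : ℤ)
    (C : Context [up i I, up j J] [up (i + k - l) I', up (j + l - k) J'])
    (h₁ : C.Admits (square (up i I) (up j J) (up k K) (up (i + k) M) (up (j - k) N) (up l L)
      (up (i + k - l) I') (up (j + l - k) J')))
    (h₂ : C.Admits (double (up i I) (up j J) (up (i + j) S)
      (up (i + k - l) I') (up (j + l - k) J')))
    (h₃ : C.Admits (rungLeft (up i I) (up j J) (up (k - l) E)
      (up (i + k - l) I') (up (j + l - k) J'))) :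
    C.value (square (up i I) (up j J) (up k K) (up (i + k) M) (up (j - k) N) (up l L)
        (up (i + k - l) I') (up (j + l - k) J')) =
      br (2 * j) * br (2 * l) / br (2 * j + 2 * l - 2 * k) *
          C.value (double (up i I) (up j J) (up (i + j) S)
            (up (i + k - l) I') (up (j + l - k) J')) +
        br (2 * i + 2 * k - 2 * l) * br (2 * j - 2 * k) / br (2 * j + 2 * l - 2 * k) *
          C.value (rungLeft (up i I) (up j J) (up (k - l) E)
            (up (i + k - l) I') (up (j + l - k) J')) := by
  have hq := q_ne_zero
  obtain ⟨-, hj, -, -, hv⟩ := mult_ne_zero_of_double h₂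
  simp only [up] at hv hj
  -- Here `j + l - k` is the multiplicity of the top right end.
  have hD : br (2 * j + 2 * l - 2 * k) ≠ 0 := br_ne_zero (by omega)
  refine C.value_eq_add_div hD h₁.1 h₂.1 h₃.1 ?_
  clear h₁ h₂ h₃ hD
  simp only [List.length_cons, List.length_nil, zero_add, forall_states_succ, forall_states_zero]
  -- If the side between the rungs vanishes, the ladder is `{2j}_q` times the merge-and-split
  -- diagram by definition. The coefficient of the single rung contains `br 0`, and that of the
  -- other diagram reduces to `{2j}_q`.
  by_cases hn : j - k = 0
  · obtain rfl : j = k := by linarith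
    have e₁ : 2 * j + 2 * l - 2 * j = 2 * l := by ring
    simp only [square, double, up, hn, if_true, e₁, sub_self, br_zero, mul_zero, zero_mul,
      add_zero, matrix_split_nil, matrix_merge_nil, List.length_nil, Word.matrix_nil]
    simp [splitWeight, mergeWeight, vertexWeight]
    ring_nf
    tauto
  simp only [square, up, hn, if_false]
  clear hn
  -- Removing a rung of multiplicity zero changes the word, so `k = 0`, `l = 0` and `k = l` are
  -- separate computations.
  by_cases hk : k = 0
  · subst hk
    by_cases hl : l = 0
    · subst hl
      simp only [double, rungLeft, rungRight, up, if_true, if_false, sub_self, br_zero,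
        mul_zero, zero_mul, add_zero, zero_add, sub_zero, List.append_nil, Word.matrix_nil]
      intros
      ring
    · simp only [double, rungLeft, rungRight, up, hl, if_true, if_false, zero_sub,
        neg_eq_zero, mul_zero, add_zero, sub_zero, List.nil_append, matrix_split_nil,
        matrix_split_singleton, matrix_merge_nil, matrix_merge_singleton, List.length_nil,
        List.length_cons, Word.matrix_nil]
      simp [splitWeight, mergeWeight, vertexWeight, br]
      and_intros
      all_goals simp only [mul_sub, sub_mul, div_eq_mul_inv, one_mul, neg_mul, mul_neg, neg_neg,
        neg_sub, mul_one, ← zpow_neg, ← zpow_add₀ hq]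
      all_goals ring_nf
  by_cases hl : l = 0
  · subst hl
    simp only [double, rungLeft, rungRight, up, hk, if_true, if_false, sub_zero,
      br_zero, mul_zero, zero_mul, zero_add, add_zero, List.append_nil, List.cons_append,
      List.nil_append, matrix_split_nil,
      matrix_split_singleton, matrix_merge_nil, matrix_merge_singleton, List.length_nil,
      List.length_cons, Word.matrix_nil]
    simp [splitWeight, mergeWeight, vertexWeight, br]
    and_intros
    all_goals simp only [mul_sub, sub_mul, div_eq_mul_inv, one_mul, neg_mul, mul_neg, neg_neg,
      neg_sub, mul_one, ← zpow_neg, ← zpow_add₀ hq]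
    all_goals ring_nf
  by_cases hkl : k - l = 0
  · obtain rfl : k = l := by linarith
    simp only [double, rungLeft, rungRight, up, hk, sub_self, if_true, if_false,
      List.cons_append, List.nil_append, matrix_split_nil,
      matrix_split_singleton, matrix_merge_nil, matrix_merge_singleton, List.length_nil,
      List.length_cons, Word.matrix_nil]
    simp [splitWeight, mergeWeight, vertexWeight, br]
    and_intros
    all_goals simp only [mul_sub, sub_mul, mul_add, add_mul, neg_mul, mul_neg, neg_neg,
      neg_sub, ← zpow_neg, ← zpow_add₀ hq]
    all_goals ring_nf
  · simp only [double, rungLeft, rungRight, up, hk, hl, hkl, if_true, if_false,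
      List.cons_append, List.nil_append, matrix_split_nil,
      matrix_split_singleton, matrix_merge_nil, matrix_merge_singleton, List.length_nil,
      List.length_cons, Word.matrix_nil]
    simp [splitWeight, mergeWeight, vertexWeight, br]
    and_intros
    all_goals simp only [mul_sub, sub_mul, mul_add, add_mul, neg_mul, mul_neg, neg_neg,
      neg_sub, ← zpow_neg, ← zpow_add₀ hq]
    all_goals ring_nf

/-! ### Crossings as combinations of planar diagrams -/

/-- Vertices do not see the weights of edges, so `I` and `J` enter only through a common power of
`q`. For `i = j` the rung is formally `{2i}_q` times the identity. -/
theorem value_crossing_rungLeft (i j I J S E : ℤ)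
    (C : Context [up i I, up j J] [up j J, up i I])
    (h₁ : C.Admits (double (up i I) (up j J) (up (i + j) S) (up j J) (up i I)))
    (h₂ : C.Admits (rungLeft (up i I) (up j J) (up (j - i) E) (up j J) (up i I))) :
    C.value (crossing true (up i I) (up j J)) =
      q ^ (i - j - i * J - j * I) / br (2 * i) *
          C.value (double (up i I) (up j J) (up (i + j) S) (up j J) (up i I)) +
        -q ^ (-i - j - i * J - j * I) / br (2 * i) *
          C.value (rungLeft (up i I) (up j J) (up (j - i) E) (up j J) (up i I)) ∧
    C.value (crossing false (up i I) (up j J)) =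
      q ^ (j - i + i * J + j * I) / br (2 * i) *
          C.value (double (up i I) (up j J) (up (i + j) S) (up j J) (up i I)) +
        -q ^ (i + j + i * J + j * I) / br (2 * i) *
          C.value (rungLeft (up i I) (up j J) (up (j - i) E) (up j J) (up i I)) := by
  have hq := q_ne_zero
  obtain ⟨hi, hj, -, -, -⟩ := mult_ne_zero_of_double h₁
  constructor
  all_goals
    refine C.value_eq_add_div (br_two_mul_ne_zero hi) ⟨rfl, rfl⟩ h₁.1 h₂.1 ?_
    clear h₁ h₂
    simp only [List.length_cons, List.length_nil, zero_add, forall_states_succ, forall_states_zero]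
    by_cases h₀ : j - i = 0
    · obtain rfl : j = i := by linarith
      simp only [crossing, matrix_cross, double, rungLeft, up, sub_self, if_true,
        matrix_split_nil, matrix_split_singleton, matrix_merge_nil, matrix_merge_singleton,
        List.length_nil, List.length_cons, Word.matrix_nil]
      simp [splitWeight, mergeWeight, vertexWeight, br, crossWeight]
      and_intros
      all_goals simp only [mul_sub, sub_mul, div_eq_mul_inv, one_mul, neg_mul, mul_neg, neg_neg,
        neg_sub, mul_one, ← zpow_neg, ← zpow_add₀ hq]
      all_goals ring_nf
    · simp only [crossing, matrix_cross, double, rungLeft, up, h₀, if_false,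
        matrix_split_nil, matrix_split_singleton, matrix_merge_nil, matrix_merge_singleton,
        List.length_nil, List.length_cons, Word.matrix_nil]
      simp [splitWeight, mergeWeight, vertexWeight, br, crossWeight]
      and_intros
      all_goals simp only [mul_sub, sub_mul, div_eq_mul_inv, one_mul, neg_mul, mul_neg, neg_neg,
        neg_sub, mul_one, ← zpow_neg, ← zpow_add₀ hq]
      all_goals ring_nf

theorem value_crossing_rungRight (i j I J S E : ℤ)
    (C : Context [up i I, up j J] [up j J, up i I])
    (h₁ : C.Admits (double (up i I) (up j J) (up (i + j) S) (up j J) (up i I)))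
    (h₂ : C.Admits (rungRight (up i I) (up j J) (up (i - j) E) (up j J) (up i I))) :
    C.value (crossing true (up i I) (up j J)) =
      q ^ (j - i - i * J - j * I) / br (2 * j) *
          C.value (double (up i I) (up j J) (up (i + j) S) (up j J) (up i I)) +
        -q ^ (-i - j - i * J - j * I) / br (2 * j) *
          C.value (rungRight (up i I) (up j J) (up (i - j) E) (up j J) (up i I)) ∧
    C.value (crossing false (up i I) (up j J)) =
      q ^ (i - j + i * J + j * I) / br (2 * j) *
          C.value (double (up i I) (up j J) (up (i + j) S) (up j J) (up i I)) +
        -q ^ (i + j + i * J + j * I) / br (2 * j) *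
          C.value (rungRight (up i I) (up j J) (up (i - j) E) (up j J) (up i I)) := by
  have hq := q_ne_zero
  obtain ⟨hi, hj, -, -, -⟩ := mult_ne_zero_of_double h₁
  constructor
  all_goals
    refine C.value_eq_add_div (br_two_mul_ne_zero hj) ⟨rfl, rfl⟩ h₁.1 h₂.1 ?_
    clear h₁ h₂
    simp only [List.length_cons, List.length_nil, zero_add, forall_states_succ, forall_states_zero]
    by_cases h₀ : i - j = 0
    · obtain rfl : i = j := by linarith
      simp only [crossing, matrix_cross, double, rungRight, up, sub_self, if_true,
        matrix_split_nil, matrix_split_singleton, matrix_merge_nil, matrix_merge_singleton,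
        List.length_nil, List.length_cons, Word.matrix_nil]
      simp [splitWeight, mergeWeight, vertexWeight, br, crossWeight]
      and_intros
      all_goals simp only [mul_sub, sub_mul, div_eq_mul_inv, one_mul, neg_mul, mul_neg, neg_neg,
        neg_sub, mul_one, ← zpow_neg, ← zpow_add₀ hq]
      all_goals ring_nf
    · simp only [crossing, matrix_cross, double, rungRight, up, h₀, if_false,
        matrix_split_nil, matrix_split_singleton, matrix_merge_nil, matrix_merge_singleton,
        List.length_nil, List.length_cons, Word.matrix_nil]
      simp [splitWeight, mergeWeight, vertexWeight, br, crossWeight]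
      and_intros
      all_goals simp only [mul_sub, sub_mul, div_eq_mul_inv, one_mul, neg_mul, mul_neg, neg_neg,
        neg_sub, mul_one, ← zpow_neg, ← zpow_add₀ hq]
      all_goals ring_nf

end Viro

theorem mainTheorem2 :
    -- the morphism of a cut diagram is the multiplication by `{2j}_q` times the polynomial
    (∀ (x : Pt) (W : Word), IsCutDiagram x W → ∀ s t : Bool,
      W.matrix [s] [t] = if s = t then br (2 * x.mult) * alexander x W else 0) ∧
    -- (i) the circle, of either orientation: the round circle cut open at its leftmost point, and
    -- the cut circle drawn as a vertical segment
    (∀ x : Pt, x.mult ≠ 0 →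
      alexander x.flip (cutLeft [⟨[], .cup x, []⟩] x [x.flip] [⟨[], .cap x, []⟩]) =
        1 / br (2 * x.mult) ∧
      alexander x [] = 1 / br (2 * x.mult)) ∧
    -- (ii)
    (∀ (x : Pt) (W : Word), IsCutDiagram x W → W.Disconnected → alexander x W = 0) ∧
    -- (iii)
    (∀ (x : Pt) (C : Context [x] [x]),
      C.value (twisted true x) = q ^ (-(x.mult * x.wt)) * C.value strands ∧
      C.value (twisted false x) = q ^ (x.mult * x.wt) * C.value strands) ∧
    -- (iv)
    (∀ (x y z : Pt) (C : Context [x] [x]), C.Admits (bigon x y z) →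
      C.value (bigon x y z) = br (2 * x.mult) * C.value strands) ∧
    -- (v)
    (∀ (i j I J S T U V E : ℤ) (C : Context [up j J, dn i I] [up j J, dn i I]),
      C.Admits (antiSquare (up j J) (dn i I) (up (i + j) S) (up (i + j) T) (dn i U) (up j V)) →
      C.Admits (antiDouble (up j J) (dn i I) (dn (i - j) E)) →
      C.value (antiSquare (up j J) (dn i I) (up (i + j) S) (up (i + j) T) (dn i U) (up j V)) =
        br (2 * i + 2 * j) * C.value (antiDouble (up j J) (dn i I) (dn (i - j) E)) +
          br (2 * j) ^ 2 * C.value strands) ∧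
    -- (vi)
    (∀ (i j k I J K R R' T : ℤ) (C : Context [up (i + j + k) T] [up i I, up j J, up k K]),
      C.Admits (splitLeft (up (i + j + k) T) (up (i + j) R) (up i I) (up j J) (up k K)) →
      C.Admits (splitRight (up (i + j + k) T) (up (j + k) R') (up i I) (up j J) (up k K)) →
      C.value (splitLeft (up (i + j + k) T) (up (i + j) R) (up i I) (up j J) (up k K)) =
        br (2 * i + 2 * j) / br (2 * j + 2 * k) *
          C.value (splitRight (up (i + j + k) T) (up (j + k) R') (up i I) (up j J) (up k K))) ∧
    (∀ (i j k I J K R R' T : ℤ) (C : Context [up i I, up j J, up k K] [up (i + j + k) T]),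
      C.Admits (mergeLeft (up (i + j + k) T) (up (i + j) R) (up i I) (up j J) (up k K)) →
      C.Admits (mergeRight (up (i + j + k) T) (up (j + k) R') (up i I) (up j J) (up k K)) →
      C.value (mergeLeft (up (i + j + k) T) (up (i + j) R) (up i I) (up j J) (up k K)) =
        C.value (mergeRight (up (i + j + k) T) (up (j + k) R') (up i I) (up j J) (up k K))) ∧
    -- (vii)
    (∀ (i j k l I J I' J' K L M N S E : ℤ)
      (C : Context [up i I, up j J] [up (i + k - l) I', up (j + l - k) J']),
      C.Admits (square (up i I) (up j J) (up k K) (up (i + k) M) (up (j - k) N) (up l L)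
        (up (i + k - l) I') (up (j + l - k) J')) →
      C.Admits (double (up i I) (up j J) (up (i + j) S)
        (up (i + k - l) I') (up (j + l - k) J')) →
      C.Admits (rungLeft (up i I) (up j J) (up (k - l) E)
        (up (i + k - l) I') (up (j + l - k) J')) →
      C.value (square (up i I) (up j J) (up k K) (up (i + k) M) (up (j - k) N) (up l L)
          (up (i + k - l) I') (up (j + l - k) J')) =
        br (2 * j) * br (2 * l) / br (2 * j + 2 * l - 2 * k) *
            C.value (double (up i I) (up j J) (up (i + j) S)
              (up (i + k - l) I') (up (j + l - k) J')) +
          br (2 * i + 2 * k - 2 * l) * br (2 * j - 2 * k) / br (2 * j + 2 * l - 2 * k) *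
            C.value (rungLeft (up i I) (up j J) (up (k - l) E)
              (up (i + k - l) I') (up (j + l - k) J'))) ∧
    -- (viii)
    (∀ (i j I J S E E' : ℤ) (C : Context [up i I, up j J] [up j J, up i I]),
      C.Admits (double (up i I) (up j J) (up (i + j) S) (up j J) (up i I)) →
      (C.Admits (rungLeft (up i I) (up j J) (up (j - i) E) (up j J) (up i I)) →
        C.value (crossing true (up i I) (up j J)) =
          q ^ (i - j - i * J - j * I) / br (2 * i) *
              C.value (double (up i I) (up j J) (up (i + j) S) (up j J) (up i I)) +
            -q ^ (-i - j - i * J - j * I) / br (2 * i) *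
              C.value (rungLeft (up i I) (up j J) (up (j - i) E) (up j J) (up i I)) ∧
        C.value (crossing false (up i I) (up j J)) =
          q ^ (j - i + i * J + j * I) / br (2 * i) *
              C.value (double (up i I) (up j J) (up (i + j) S) (up j J) (up i I)) +
            -q ^ (i + j + i * J + j * I) / br (2 * i) *
              C.value (rungLeft (up i I) (up j J) (up (j - i) E) (up j J) (up i I))) ∧
      (C.Admits (rungRight (up i I) (up j J) (up (i - j) E') (up j J) (up i I)) →
        C.value (crossing true (up i I) (up j J)) =
          q ^ (j - i - i * J - j * I) / br (2 * j) *
              C.value (double (up i I) (up j J) (up (i + j) S) (up j J) (up i I)) +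
            -q ^ (-i - j - i * J - j * I) / br (2 * j) *
              C.value (rungRight (up i I) (up j J) (up (i - j) E') (up j J) (up i I)) ∧
        C.value (crossing false (up i I) (up j J)) =
          q ^ (i - j + i * J + j * I) / br (2 * j) *
              C.value (double (up i I) (up j J) (up (i + j) S) (up j J) (up i I)) +
            -q ^ (i + j + i * J + j * I) / br (2 * j) *
              C.value (rungRight (up i I) (up j J) (up (i - j) E') (up j J) (up i I)))) := by
  exact ⟨fun x W h => h.matrix_eq, fun x _ => ⟨alexander_circle x, alexander_strand⟩,
    fun x W => alexander_eq_zero_of_disconnected, value_twisted, value_bigon, value_antiSquare,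
    value_splitLeft, value_mergeLeft, value_square, fun i j I J S E E' C h =>
      ⟨value_crossing_rungLeft i j I J S E C h, value_crossing_rungRight i j I J S E' C h⟩⟩
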